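/- **Setting.** Let $\mathcal C$, $S$, $A$ be finite sets of contexts, states and actions and $H$ a horizon. For every context $c$ there is an MDP with dynamics $P^c_\star(\cdot\mid s,a)$, and reward distributions on $[0,1]$ with means $r^c_\star(s,a)$. The dynamics is layered: for each $c$, $S$ is partitioned into layers $S^c_0=\{s_0\},S^c_1,\dots,S^c_H=\{s_H\}$, and transitions lead from $S^c_h$ to $S^c_{h+1}$ only. Episodes start in $s_0$ and last $H$ steps; no reward is collected in $s_H$. For a policy $\pi:S\to A$ let $q_h(s\mid\pi,P)$ be the probability of being in $s$ at time $h$, $q(s\mid\pi,P)$ the probability of visiting $s$, and $V^\pi_{P,r}=\mathbb E\big[\sum_{h=0}^{H-1} r(s_h,\pi(s_h))\big]$. Assume minimum reachability: for some $p_{\min}\in(0,1]$, $q_h(s\mid\pi,P^c_\star)\ge p_{\min}$ for all $c$, $h<H$, $s\in S^c_h$ and $\pi:S\to A$. Let $\mathcal F$ be a finite class of functions $\mathcal C\times S\times A\to[0,1]$ that is realizable: some $f_\star\in\mathcal F$ satisfies $f_\star(c,s,a)=r^c_\star(s,a)$ for all $c$, $a$ and all $s\neq s_H$. In round $t=1,\dots,T$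 a context $c_t$ is drawn i.i.d. from an unknown distribution $\mathcal D$ on $\mathcal C$, the learner (who knows $P_\star$) plays a policy $\pi_t(c_t;\cdot)$ and observes a trajectory $(s^t_h,a^t_h,r^t_h)_{h<H}$ of it. The regret is $\mathrm{Regret}_T=\sum_{t=1}^T\big(V^{\pi^\star(c_t;\cdot)}_{P^{c_t}_\star,r^{c_t}_\star}-V^{\pi_t(c_t;\cdot)}_{P^{c_t}_\star,r^{c_t}_\star}\big)$, where $\pi^\star(c;\cdot)$ is optimal for every $c$. **Algorithm RM-KD** (parameters $\beta_t$). In rounds $t\le|A|$ it always plays the $t$-th action. In a round $t>|A|$ it takes a least-squares minimizer $\hat f_t\in\arg\min_{f\in\mathcal F}\sum_{i<t}\sum_{h<H}(f(c_i,s^i_h,a^i_h)-r^i_h)^2$, and for every context $c$ a policy $\pi_t(c;\cdot)\in\arg\max_{\pi:S\to A}V^\pi_{P^c_\star,\hat r^c_t}$, where $$\hat r^c_t(s,a)=\hat f_t(c,s,a)+\frac{\beta_t}{\sum_{i<t}\mathbb 1[a=\pi_i(c;s)]\,q(s\mid\pi_i(c;\cdot),P^c_\star)} .$$ Ties are broken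 by any (measurable) rule depending on the history. **Theorem.** There are universal constants $K>0$ and $k\in\mathbb N$ such that the following holds for all such contextual MDPs, all $T\ge1$ and $\delta\in(0,1)$, when RM-KD is run with $\beta_t=\sqrt{17\,t\log(4|\mathcal F|t^3/\delta)/(|S||A|)}$. 1. With probability at least $1-\delta$, $$\mathrm{Regret}_T\le K(1+\log T)^k\Big(\big(\tfrac1{p_{\min}}+H\big)\sqrt{T|S||A|\log(2|\mathcal F|/\delta)}+|A|H\Big),$$ and if $T>|A|$, then with probability at least $1-\delta$ the same bound holds without the term $|A|H$. 2. Let $\mathcal F=\mathcal G^S$, that is, $\mathcal F$ consists of all $f(c,s,a)=g_s(c,a)$ with $g_s\in\mathcal G$, for a finite class $\mathcal G$ of functions $\mathcal C\times A\to[0,1]$. Then with probability at least $1-\delta$, $$\mathrm{Regret}_T\le K(1+\log T)^k\Big(\big(\tfrac1{p_{\min}}+H\big)|S|\sqrt{T|A|\log(2|\mathcal G|/\delta)}+|A|H\Big),$$ and if $T>|A|$, then with probability at least $1-\delta$ the same bound holds without the term $|A|H$. -/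

import Mathlib

open MeasureTheory

noncomputable section

namespace CMDP

/-- A contextual MDP with horizon `H`, contexts `C`, states `S`, actions `A`.  Contexts are drawn
from `ctxDist`.  The dynamics `P c` of every context is layered and loop-free: `layer c s` is the
index of the layer of `s`, transitions go from each layer to the next one, the first layer is
`{s₀}` and the last one is `{sH}`.  The reward of action `a` in state `s` is drawn from `R c s a`,
a distribution on `[0,1]`.  An episode ends at `sH`, and nothing is collected there. -/
structure LayeredCMDP (C S A : Type*) (H : ℕ) where
  ctxDist : PMF C
  s₀ : S
  sH : S
  layer : C → S → ℕ
  layer_le : ∀ c s, layer c s ≤ H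
  layer_eq_zero_iff : ∀ c s, layer c s = 0 ↔ s = s₀
  layer_eq_H_iff : ∀ c s, layer c s = H ↔ s = sH
  P : C → S → A → PMF S
  P_layer : ∀ c s a s', layer c s < H → P c s a s' ≠ 0 → layer c s' = layer c s + 1
  R : C → S → A → Measure ℝ
  R_prob : ∀ c s a, IsProbabilityMeasure (R c s a)
  R_support : ∀ c s a, ∀ᵐ x ∂(R c s a), x ∈ Set.Icc (0 : ℝ) 1

section MDP

variable {S A : Type*}

/-- The law of the state at time `h` when the policy `π` is played on the dynamics `P`. -/
def stateLaw (P : S → A → PMF S) (s₀ : S) (π : S → A) : ℕ → PMF S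
  | 0 => PMF.pure s₀
  | h + 1 => (stateLaw P s₀ π h).bind fun s => P s (π s)

/-- The occupancy measure `q_h(s | π, P)`. -/
def occ (P : S → A → PMF S) (s₀ : S) (π : S → A) (h : ℕ) (s : S) : ℝ :=
  (stateLaw P s₀ π h s).toReal

/-- The probability `q(s | π, P)` of visiting `s` during an episode.  The dynamics are loop-free, so
`s` is visited at most once and the events "`s` is visited at time `h`" are disjoint. -/
def visitProb (H : ℕ) (P : S → A → PMF S) (s₀ : S) (π : S → A) (s : S) : ℝ :=
  ∑ h ∈ Finset.range (H + 1), occ P s₀ π h s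

/-- The value `V^π(s₀)`, the expectation of `∑_{h < H} r(s_h, π(s_h))`. -/
def value [Fintype S] (H : ℕ) (P : S → A → PMF S) (s₀ : S) (r : S → A → ℝ) (π : S → A) : ℝ :=
  ∑ h ∈ Finset.range H, ∑ s, occ P s₀ π h s * r s (π s)

end MDP

/-- One observed episode: the context and the triples `(s_h, a_h, r_h)` for `h < H`. The state at
time `H` is always `sH` and is not recorded. -/
abbrev Episode (C S A : Type*) (H : ℕ) := C × (Fin H → S × A × ℝ)

/-- The history of the first `t` episodes. -/
abbrev Hist (C S A : Type*) (H t : ℕ) := Fin t → Episode C S A H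

/-- The first `i` episodes of a history. -/
def Hist.pre {C S A : Type*} {H t : ℕ} (hist : Hist C S A H t) (i : Fin t) : Hist C S A H i :=
  fun j => hist ⟨j, j.2.trans i.2⟩

/-- The squared loss `∑_i ∑_h (f(c_i, s_h^i, a_h^i) - r_h^i)²` of `f` on a history. -/
def sqLoss {C S A : Type*} {H t : ℕ} (f : C → S → A → ℝ) (hist : Hist C S A H t) : ℝ :=
  ∑ i, ∑ h, (f (hist i).1 ((hist i).2 h).1 ((hist i).2 h).2.1 - ((hist i).2 h).2.2) ^ 2

namespace LayeredCMDP

variable {C S A : Type*} {H : ℕ} (M : LayeredCMDP C S A H)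

/-- The expected reward `r^c(s,a)`. -/
def meanReward (c : C) (s : S) (a : A) : ℝ := ∫ x, x ∂(M.R c s a)

/-- Minimum reachability with parameter `p`. -/
def MinReach (p : ℝ) : Prop :=
  ∀ (c : C) (h : ℕ) (s : S), h < H → M.layer c s = h →
    ∀ π : C → S → A, p ≤ occ (M.P c) M.s₀ (π c) h s

/-- Realizability of the mean rewards by a class `F` (at the states where rewards are collected). -/
def Realizable (F : Finset (C → S → A → ℝ)) : Prop :=
  ∃ f ∈ F, ∀ c s a, s ≠ M.sH → f c s a = M.meanReward c s a

/-- The value of a policy in the true MDP of context `c`. -/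
def trueValue [Fintype S] (c : C) (π : S → A) : ℝ :=
  value H (M.P c) M.s₀ (M.meanReward c) π

/-- `πs` is an optimal context-dependent policy. -/
def IsOptimal [Fintype S] (πs : C → S → A) : Prop :=
  ∀ (c : C) (π : S → A), M.trueValue c π ≤ M.trueValue c (πs c)

variable [Fintype C] [Fintype S] [MeasurableSpace C] [MeasurableSpace S] [MeasurableSpace A]

/-- The law of `n` consecutive triples (state, action, reward), starting at `s`, when the policy `π`
is played in context `c`: the reward is drawn from `R c s (π s)` and, independently, the next state
from `P c s (π s)`. -/
def trajLaw (c : C) (π : S → A) : (n : ℕ) → S → Measure (Fin n → S × A × ℝ)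
  | 0, _ => Measure.dirac Fin.elim0
  | n + 1, s =>
    ((M.R c s (π s)).prod (∑ s', M.P c s (π s) s' • trajLaw c π n s')).map
      fun x => Fin.cons (α := fun _ => S × A × ℝ) (s, π s, x.1) x.2

/-- The law of an episode in which the context-dependent policy `π` is played: the context is drawn
from `ctxDist`, and then the trajectory is generated by `π c`. -/
def episodeLaw (π : C → S → A) : Measure (Episode C S A H) :=
  ∑ c, M.ctxDist c • (M.trajLaw c (π c) H M.s₀).map (Prod.mk c)

/-- The law of the first `t` episodes when in the round that follows the history `hist` (of length
`i`) the context-dependent policy `π i hist` is played. -/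
def histLaw (π : (i : ℕ) → Hist C S A H i → C → S → A) : (t : ℕ) → Measure (Hist C S A H t)
  | 0 => Measure.dirac Fin.elim0
  | t + 1 => (histLaw π t).bind fun hist =>
      (M.episodeLaw (π t hist)).map (Fin.snoc (α := fun _ => Episode C S A H) hist)

/-- The regret of the policies `π` against `πs` along a history. -/
def regret (πs : C → S → A) (π : (i : ℕ) → Hist C S A H i → C → S → A) {T : ℕ}
    (hist : Hist C S A H T) : ℝ :=
  ∑ t : Fin T, (M.trueValue (hist t).1 (πs (hist t).1) -
    M.trueValue (hist t).1 (π t (hist.pre t) (hist t).1))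

end LayeredCMDP

open Classical in
/-- The optimistic reward function for context `c` after the policies `past 0, …, past (t-1)`:
`f(c,s,a) + b / ∑_{i<t} 𝟙[a = past i (c;s)] q(s | past i (c;·), P)`. -/
def optReward {C S A : Type*} {H t : ℕ} (M : LayeredCMDP C S A H) (f : C → S → A → ℝ) (b : ℝ)
    (past : Fin t → C → S → A) (c : C) (s : S) (a : A) : ℝ :=
  f c s a + b / ∑ i, if a = past i c s then visitProb H (M.P c) M.s₀ (past i c) s else 0

/-- A realization of the algorithm RM-KD with function class `F` and tuning parameters `β`, given by
the choices that the least-squares oracle and the planner make after every history.  Rounds are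
counted from `0`, so that the round after a history of length `t` is round `t + 1` of the usual
numbering and uses `β (t + 1)`. In the first `|A|` rounds the actions are played one after the other.
In a later round, `fhat` is a least-squares minimizer over `F` on the data so far, and the policy is,
in every context, optimal for the true dynamics with the optimistic rewards. -/
structure RMKD {C S A : Type*} {H : ℕ} [Fintype S] [Fintype A] [MeasurableSpace C]
    [MeasurableSpace S] [MeasurableSpace A] (M : LayeredCMDP C S A H)
    (F : Finset (C → S → A → ℝ)) (β : ℕ → ℝ) where
  order : Fin (Fintype.card A) ≃ A
  fhat : (t : ℕ) → Hist C S A H t → C → S → A → ℝ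
  policy : (t : ℕ) → Hist C S A H t → C → S → A
  measurable_policy : ∀ t, Measurable (policy t)
  policy_init : ∀ (t : ℕ) (ht : t < Fintype.card A) (hist : Hist C S A H t) (c : C) (s : S),
    policy t hist c s = order ⟨t, ht⟩
  fhat_mem : ∀ (t : ℕ), Fintype.card A ≤ t → ∀ hist : Hist C S A H t, fhat t hist ∈ F
  fhat_le : ∀ (t : ℕ), Fintype.card A ≤ t → ∀ hist : Hist C S A H t, ∀ f ∈ F,
    sqLoss (fhat t hist) hist ≤ sqLoss f hist
  policy_opt : ∀ (t : ℕ), Fintype.card A ≤ t → ∀ (hist : Hist C S A H t) (c : C) (π : S → A),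
    value H (M.P c) M.s₀
        (optReward M (fhat t hist) (β (t + 1)) (fun i : Fin t => policy i (hist.pre i)) c) π ≤
      value H (M.P c) M.s₀
        (optReward M (fhat t hist) (β (t + 1)) (fun i : Fin t => policy i (hist.pre i)) c)
        (policy t hist c)

/-- `β_t = sqrt (17 t log(4 |F| t³ / δ) / (|S| |A|))`. -/
def beta (cardF cardS cardA : ℕ) (δ : ℝ) (t : ℕ) : ℝ :=
  Real.sqrt (17 * t * Real.log (4 * cardF * (t : ℝ) ^ 3 / δ) / (cardS * cardA))

open Classical in
/-- The class `G^S` of all functions `f(c,s,a) = g_s(c,a)` with `g_s ∈ G` for every state `s`. -/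
def powClass {C S A : Type*} [Fintype S] (G : Finset (C → A → ℝ)) : Finset (C → S → A → ℝ) :=
  (Fintype.piFinset fun _ : S => G).image fun g c s a => g s c a

end CMDP

end

universe u v w

open CMDP

/-!
The expected suboptimality of an optimistic policy is controlled by its own bonuses and by the
squared errors of the reward estimate on the policies played before: by AM-GM the error `|f - g|` at
a state-action pair is at most a bonus plus a multiple of the squared error weighted by `w`, where
`w` is the expected number of past visits, and summing the weighted squared errors over the pairs
gives the expected squared errors along the past episodes. Minimum reachability bounds `w` from
below by `p_min` times the number of past rounds whose policy plays the action, so that the bonuses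
add up to harmonic sums. The least-squares estimate has small expected squared errors because the
excess loss of `f` over the true means has mean equal to its squared error and variance at most a
multiple of it, so that an exponential supermartingale bounds the squared errors by the empirical
excess losses. The same supermartingale, applied to the suboptimalities, passes from the expected
suboptimalities to the regret.
-/

namespace CMDP

theorem sum_toReal_pmf {ι : Type*} [Fintype ι] (p : PMF ι) : ∑ i, (p i).toReal = 1 := by
  rw [← ENNReal.toReal_sum fun i _ => p.apply_ne_top i, ← tsum_fintype (L := .unconditional _),
    p.tsum_coe, ENNReal.toReal_one]

/-! ### Occupancy measures and values -/

section Value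

variable {S A : Type*} (P : S → A → PMF S) (s₀ : S) (π : S → A)

theorem occ_nonneg (h : ℕ) (s : S) : 0 ≤ occ P s₀ π h s := ENNReal.toReal_nonneg

theorem occ_le_one (h : ℕ) (s : S) : occ P s₀ π h s ≤ 1 :=
  ENNReal.toReal_le_of_le_ofReal zero_le_one (by simpa using PMF.coe_le_one _ s)

theorem visitProb_nonneg (H : ℕ) (s : S) : 0 ≤ visitProb H P s₀ π s :=
  Finset.sum_nonneg fun h _ => occ_nonneg P s₀ π h s

variable [Fintype S] (H : ℕ)

theorem sum_occ (h : ℕ) : ∑ s, occ P s₀ π h s = 1 := sum_toReal_pmf _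

theorem value_one : value H P s₀ (fun _ _ => 1) π = H := by
  simp [value, sum_occ]

theorem value_add (r r' : S → A → ℝ) :
    value H P s₀ (fun s a => r s a + r' s a) π = value H P s₀ r π + value H P s₀ r' π := by
  simp only [value, mul_add, Finset.sum_add_distrib]

theorem value_const_mul (b : ℝ) (r : S → A → ℝ) :
    value H P s₀ (fun s a => b * r s a) π = b * value H P s₀ r π := by
  simp only [value, Finset.mul_sum, mul_left_comm]

end Value

namespace LayeredCMDP

section Occupancy

variable {C S A : Type*} {H : ℕ} (M : LayeredCMDP C S A H)

theorem layer_lt {c : C} {s : S} (hs : s ≠ M.sH) : M.layer c s < H :=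
  (M.layer_le c s).lt_of_ne fun h => hs ((M.layer_eq_H_iff c s).1 h)

theorem layer_eq_of_mem_support_stateLaw {c : C} {π : S → A} {h : ℕ} (hh : h ≤ H) {s : S}
    (hs : s ∈ (stateLaw (M.P c) M.s₀ π h).support) : M.layer c s = h := by
  induction h generalizing s with
  | zero => exact (M.layer_eq_zero_iff c s).2 (by simpa [stateLaw] using hs)
  | succ h ih =>
    obtain ⟨s', hs', hss'⟩ := (PMF.mem_support_bind_iff _ _ _).1 hs
    have hlayer : M.layer c s' = h := ih (Nat.le_of_succ_le hh) hs'
    rw [← hlayer]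
    exact M.P_layer c s' _ s (by omega) hss'

theorem occ_eq_zero {c : C} {π : S → A} {h : ℕ} (hh : h ≤ H) {s : S} (hs : M.layer c s ≠ h) :
    occ (M.P c) M.s₀ π h s = 0 := by
  have hsupp : s ∉ (stateLaw (M.P c) M.s₀ π h).support :=
    fun hmem => hs (M.layer_eq_of_mem_support_stateLaw hh hmem)
  rw [occ, (PMF.apply_eq_zero_iff _ _).2 hsupp, ENNReal.toReal_zero]

theorem visitProb_eq_occ (c : C) (π : S → A) (s : S) :
    visitProb H (M.P c) M.s₀ π s = occ (M.P c) M.s₀ π (M.layer c s) s :=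
  Finset.sum_eq_single_of_mem _ (Finset.mem_range_succ_iff.2 (M.layer_le c s)) fun _ hh hne =>
    M.occ_eq_zero (Finset.mem_range_succ_iff.1 hh) hne.symm

theorem visitProb_le_one (c : C) (π : S → A) (s : S) :
    visitProb H (M.P c) M.s₀ π s ≤ 1 := by
  rw [M.visitProb_eq_occ]
  exact occ_le_one _ _ _ _ _

theorem MinReach.le_visitProb {M : LayeredCMDP C S A H} {p : ℝ} (hM : M.MinReach p) (c : C)
    {s : S} (hs : s ≠ M.sH) (π : S → A) : p ≤ visitProb H (M.P c) M.s₀ π s := by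
  rw [M.visitProb_eq_occ]
  exact hM c _ s (M.layer_lt hs) rfl fun _ => π

variable [Fintype S]

theorem value_eq_sum_visitProb [DecidableEq S] (c : C) (r : S → A → ℝ) (π : S → A) :
    value H (M.P c) M.s₀ r π =
      ∑ s with s ≠ M.sH, visitProb H (M.P c) M.s₀ π s * r s (π s) := by
  have hvisit (s : S) : ∑ h ∈ Finset.range H, occ (M.P c) M.s₀ π h s =
      if s ≠ M.sH then visitProb H (M.P c) M.s₀ π s else 0 := by
    split_ifs with hs
    · rw [visitProb, Finset.sum_range_succ, M.occ_eq_zero le_rfl (M.layer_lt hs).ne, add_zero]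
    · refine Finset.sum_eq_zero fun h hh => M.occ_eq_zero (Finset.mem_range.1 hh).le ?_
      rw [(M.layer_eq_H_iff c s).2 (not_not.1 hs)]
      exact (Finset.mem_range.1 hh).ne'
  simp_rw [value, Finset.sum_comm (s := Finset.range H), ← Finset.sum_mul, hvisit, ite_mul,
    zero_mul, Finset.sum_filter]

variable {c : C} {r r' : S → A → ℝ} {π : S → A}

theorem value_mono (h : ∀ s, s ≠ M.sH → r s (π s) ≤ r' s (π s)) :
    value H (M.P c) M.s₀ r π ≤ value H (M.P c) M.s₀ r' π := by
  classical
  simp_rw [M.value_eq_sum_visitProb]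
  refine Finset.sum_le_sum fun s hs => ?_
  exact mul_le_mul_of_nonneg_left (h s (Finset.mem_filter.1 hs).2) (visitProb_nonneg _ _ _ _ _)

theorem value_congr (h : ∀ s, s ≠ M.sH → r s (π s) = r' s (π s)) :
    value H (M.P c) M.s₀ r π = value H (M.P c) M.s₀ r' π :=
  (M.value_mono fun s hs => (h s hs).le).antisymm (M.value_mono fun s hs => (h s hs).ge)

theorem value_nonneg (h : ∀ s, s ≠ M.sH → 0 ≤ r s (π s)) : 0 ≤ value H (M.P c) M.s₀ r π :=
  le_of_eq_of_le (by simp [value]) (M.value_mono (r := fun _ _ => 0) h)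

theorem value_le (h : ∀ s, s ≠ M.sH → r s (π s) ≤ 1) : value H (M.P c) M.s₀ r π ≤ H :=
  (M.value_mono (r' := fun _ _ => 1) h).trans_eq (value_one _ _ _ _)

end Occupancy

end LayeredCMDP

/-! ### Optimistic policies -/

theorem le_mul_inv_add_inv_mul_sq {b w : ℝ} (hb : 0 < b) (hw : 0 < w) (d : ℝ) :
    d ≤ b * w⁻¹ + (4 * b)⁻¹ * (w * d ^ 2) := by
  have hsq : b * w⁻¹ + (4 * b)⁻¹ * (w * d ^ 2) - d = (w * d - 2 * b) ^ 2 / (4 * b * w) := by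
    field_simp
    ring
  have : 0 ≤ (w * d - 2 * b) ^ 2 / (4 * b * w) := by positivity
  linarith

namespace LayeredCMDP

section Bonus

variable {C S A : Type*} {H : ℕ} (M : LayeredCMDP C S A H) {t : ℕ} (past : Fin t → C → S → A)

open Classical in
/-- The denominator of the bonus in `optReward`: the expected number of visits of `(s, a)` under the
past policies, all of them played in context `c`. -/
noncomputable def weight (c : C) (s : S) (a : A) : ℝ :=
  ∑ i, if a = past i c s then visitProb H (M.P c) M.s₀ (past i c) s else 0

open Classical in
/-- The number of past policies that play `a` in state `s` of context `c`. -/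
noncomputable def playCount (c : C) (s : S) (a : A) : ℕ :=
  Finset.card {i | past i c s = a}

theorem weight_nonneg (c : C) (s : S) (a : A) : 0 ≤ M.weight past c s a := by
  classical
  exact Finset.sum_nonneg fun i _ => ite_nonneg (visitProb_nonneg _ _ _ _ _) le_rfl

theorem weight_eq_zero {c : C} {s : S} {a : A} (h : playCount past c s a = 0) :
    M.weight past c s a = 0 := by
  classical
  refine Finset.sum_eq_zero fun i hi => if_neg fun ha => ?_
  exact Finset.filter_eq_empty_iff.1 (Finset.card_eq_zero.1 h) hi ha.symm

theorem MinReach.playCount_le_weight {M : LayeredCMDP C S A H} {p : ℝ} (hM : M.MinReach p)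
    (c : C) {s : S} (hs : s ≠ M.sH) (a : A) :
    p * playCount past c s a ≤ M.weight past c s a := by
  classical
  simp_rw [weight, playCount, ← Finset.sum_filter, eq_comm (a := a), mul_comm p, ← nsmul_eq_mul]
  exact Finset.card_nsmul_le_sum _ _ _ fun i _ => hM.le_visitProb c hs _

theorem MinReach.weight_inv_le {M : LayeredCMDP C S A H} {p : ℝ} (hM : M.MinReach p) (hp : 0 < p)
    (c : C) {s : S} (hs : s ≠ M.sH) (a : A) :
    (M.weight past c s a)⁻¹ ≤ p⁻¹ * (playCount past c s a : ℝ)⁻¹ := by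
  rcases (playCount past c s a).eq_zero_or_pos with h | h
  · simp [M.weight_eq_zero past h, h]
  · rw [← mul_inv]
    gcongr
    exact hM.playCount_le_weight past c hs a

variable [Fintype S] {c : C}

theorem value_optReward (f : C → S → A → ℝ) (b : ℝ) (π : S → A) :
    value H (M.P c) M.s₀ (optReward M f b past c) π = value H (M.P c) M.s₀ (f c) π +
      b * value H (M.P c) M.s₀ (fun s a => (M.weight past c s a)⁻¹) π := by
  rw [← value_const_mul, ← value_add]
  rfl

theorem value_weight_mul_le {g : S → A → ℝ} (hg : ∀ s a, 0 ≤ g s a) (π : S → A) :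
    value H (M.P c) M.s₀ (fun s a => M.weight past c s a * g s a) π ≤
      ∑ i, value H (M.P c) M.s₀ g (past i c) := by
  classical
  simp_rw [M.value_eq_sum_visitProb]
  rw [Finset.sum_comm]
  refine Finset.sum_le_sum fun s _ => ?_
  have hweight : 0 ≤ M.weight past c s (π s) * g s (π s) :=
    mul_nonneg (M.weight_nonneg past c s _) (hg _ _)
  refine (mul_le_of_le_one_left hweight (M.visitProb_le_one c _ s)).trans ?_
  rw [weight, Finset.sum_mul]
  refine Finset.sum_le_sum fun i _ => ?_
  split_ifs with h
  · rw [h]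
  · rw [zero_mul]
    exact mul_nonneg (visitProb_nonneg _ _ _ _ _) (hg _ _)

theorem value_sub_value_le {b : ℝ} (hb : 0 < b)
    (hweight : ∀ s a, s ≠ M.sH → 0 < M.weight past c s a) (f g : S → A → ℝ) (π : S → A) :
    value H (M.P c) M.s₀ f π - value H (M.P c) M.s₀ g π ≤
      b * value H (M.P c) M.s₀ (fun s a => (M.weight past c s a)⁻¹) π +
        (4 * b)⁻¹ * ∑ i, value H (M.P c) M.s₀ (fun s a => (f s a - g s a) ^ 2) (past i c) := by
  have hpast := M.value_weight_mul_le past (c := c) (g := fun s a => (f s a - g s a) ^ 2)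
    (fun _ _ => sq_nonneg _) π
  refine le_trans ?_ (add_le_add_right (mul_le_mul_of_nonneg_left hpast (by positivity)) _)
  rw [sub_le_iff_le_add', ← value_const_mul, ← value_const_mul, ← value_add, ← value_add]
  refine M.value_mono fun s hs => ?_
  rw [← sub_le_iff_le_add']
  exact le_mul_inv_add_inv_mul_sq hb (hweight s _ hs) _

/-- The policy `π` is, in every context, optimal for the true dynamics and the optimistic rewards
`optReward M f b past`. -/
def IsOptimisticPolicy (f : C → S → A → ℝ) (b : ℝ) (π : C → S → A) : Prop :=
  ∀ (c : C) (π' : S → A), value H (M.P c) M.s₀ (optReward M f b past c) π' ≤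
    value H (M.P c) M.s₀ (optReward M f b past c) (π c)

variable {past M}

theorem IsOptimisticPolicy.value_sub_value_le {f : C → S → A → ℝ} {b : ℝ} {π : C → S → A}
    (hπ : M.IsOptimisticPolicy past f b π) (hb : 0 < b)
    (hweight : ∀ s a, s ≠ M.sH → 0 < M.weight past c s a) (g : S → A → ℝ) (π' : S → A) :
    value H (M.P c) M.s₀ g π' - value H (M.P c) M.s₀ g (π c) ≤
      2 * b * value H (M.P c) M.s₀ (fun s a => (M.weight past c s a)⁻¹) (π c) +
        (2 * b)⁻¹ * ∑ i, value H (M.P c) M.s₀ (fun s a => (f c s a - g s a) ^ 2) (past i c) := by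
  have hopt := hπ c π'
  rw [value_optReward, value_optReward] at hopt
  have hunder := M.value_sub_value_le past hb hweight g (f c) π'
  have hover := M.value_sub_value_le past hb hweight (f c) g (π c)
  simp_rw [sub_sq_comm (g _ _)] at hunder
  have hhalf : (2 * b)⁻¹ = (4 * b)⁻¹ + (4 * b)⁻¹ := by
    field_simp
    norm_num
  rw [hhalf, add_mul]
  linarith

end Bonus

end LayeredCMDP

section Counting

variable {ι A : Type*} [LinearOrder ι]

theorem sum_inv_card_filter_lt (s : Finset ι) :
    ∑ t ∈ s, (Finset.card {i ∈ s | i < t} : ℝ)⁻¹ = harmonic (s.card - 1) := by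
  induction s using Finset.induction_on_max with
  | empty => simp
  | insert a s hlt ih =>
    have ha : a ∉ s := fun h => (hlt a h).false
    have hmax : {i ∈ insert a s | i < a} = s := by
      rw [Finset.filter_insert, if_neg (lt_irrefl a), Finset.filter_true_of_mem hlt]
    have hinit : ∀ t ∈ s, {i ∈ insert a s | i < t} = {i ∈ s | i < t} := fun t ht => by
      rw [Finset.filter_insert, if_neg (hlt t ht).not_gt]
    rw [Finset.sum_insert ha, Finset.card_insert_of_notMem ha, hmax,
      Finset.sum_congr rfl fun t ht => by rw [hinit t ht], ih]
    rcases s.card with _ | m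
    · simp
    · simp [harmonic_succ, add_comm]

theorem sum_inv_card_filter_lt_le (s : Finset ι) {T : ℕ} (hs : s.card ≤ T) :
    ∑ t ∈ s, (Finset.card {i ∈ s | i < t} : ℝ)⁻¹ ≤ 1 + Real.log T := by
  rw [sum_inv_card_filter_lt]
  refine (harmonic_le_one_add_log _).trans ?_
  rcases (s.card - 1).eq_zero_or_pos with h | h
  · simp [h, Real.log_natCast_nonneg]
  · gcongr
    omega

theorem sum_inv_card_fiber_lt_le [Fintype ι] [Fintype A] [DecidableEq A] (u : ι → A) :
    ∑ t, (Finset.card {i | i < t ∧ u i = u t} : ℝ)⁻¹ ≤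
      Fintype.card A * (1 + Real.log (Fintype.card ι)) := by
  rw [← Finset.sum_fiberwise Finset.univ u, ← nsmul_eq_mul, ← Finset.card_univ]
  refine Finset.sum_le_card_nsmul _ _ _ fun a _ => ?_
  refine le_of_eq_of_le (Finset.sum_congr rfl fun t ht => ?_)
    (sum_inv_card_filter_lt_le {t | u t = a} (Finset.card_le_univ _))
  rw [Finset.filter_filter, (Finset.mem_filter.1 ht).2]
  simp_rw [and_comm]

end Counting

namespace LayeredCMDP

variable {C S A : Type*} {H : ℕ} {M : LayeredCMDP C S A H} {T : ℕ} (π : Fin T → C → S → A)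

theorem playCount_take [DecidableEq A] (t : Fin T) (c : C) (s : S) (a : A) :
    playCount (Fin.take t t.2.le π) c s a = Finset.card {i | i < t ∧ π i c s = a} := by
  rw [playCount, ← Finset.card_map (Fin.castLEEmb t.2.le)]
  congr 1
  ext i
  simp only [Finset.mem_map, Finset.mem_filter_univ]
  constructor
  · rintro ⟨j, hj, rfl⟩
    exact ⟨j.2, hj⟩
  · rintro ⟨hlt, hi⟩
    exact ⟨⟨i, hlt⟩, hi, rfl⟩

theorem MinReach.sum_value_weight_inv_le [Fintype S] [Fintype A] {p : ℝ} (hM : M.MinReach p)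
    (hp : 0 < p) (c : C) :
    ∑ t : Fin T, value H (M.P c) M.s₀
        (fun s a => (M.weight (Fin.take t t.2.le π) c s a)⁻¹) (π t c) ≤
      p⁻¹ * (Fintype.card S * (Fintype.card A * (1 + Real.log T))) := by
  classical
  have hround (t : Fin T) : value H (M.P c) M.s₀
      (fun s a => (M.weight (Fin.take t t.2.le π) c s a)⁻¹) (π t c) ≤
      p⁻¹ * ∑ s, (Finset.card {i | i < t ∧ π i c s = π t c s} : ℝ)⁻¹ := by
    rw [M.value_eq_sum_visitProb, Finset.mul_sum]
    refine (Finset.sum_le_sum fun s hs => ?_).trans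
      (Finset.sum_le_univ_sum_of_nonneg fun _ => by positivity)
    refine (mul_le_of_le_one_left (inv_nonneg.2 (M.weight_nonneg _ _ _ _))
      (M.visitProb_le_one c _ s)).trans ?_
    rw [← playCount_take]
    exact hM.weight_inv_le _ hp c (Finset.mem_filter.1 hs).2 _
  refine (Finset.sum_le_sum fun t _ => hround t).trans ?_
  rw [← Finset.mul_sum, Finset.sum_comm]
  gcongr
  have hstate (s : S) := sum_inv_card_fiber_lt_le fun t => π t c s
  simp_rw [Fintype.card_fin] at hstate
  simpa using Finset.sum_le_card_nsmul Finset.univ _ _ fun s _ => hstate s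

end LayeredCMDP

/-! ### The laws of trajectories and episodes -/

section Mixture

variable {ι Ω : Type*} [Fintype ι] [MeasurableSpace Ω] (p : PMF ι) {μ : ι → Measure Ω}

theorem isProbabilityMeasure_sum_smul (hμ : ∀ i, IsProbabilityMeasure (μ i)) :
    IsProbabilityMeasure (∑ i, p i • μ i) := by
  constructor
  simp only [Measure.finsetSum_apply, Measure.smul_apply, measure_univ, smul_eq_mul, mul_one]
  rw [← tsum_fintype (L := .unconditional _), p.tsum_coe]

theorem ae_sum_smul {q : Ω → Prop} (h : ∀ i, ∀ᵐ ω ∂μ i, q ω) : ∀ᵐ ω ∂∑ i, p i • μ i, q ω := by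
  rw [ae_iff, Measure.finsetSum_apply]
  exact Finset.sum_eq_zero fun i _ => ae_iff.1 (Measure.ae_smul_measure (h i) (p i))

theorem integrable_sum_smul {X : Ω → ℝ} (hX : ∀ i, Integrable X (μ i)) :
    Integrable X (∑ i, p i • μ i) :=
  integrable_finsetSum_measure.2 fun i _ => (hX i).smul_measure (p.apply_ne_top i)

theorem integral_sum_smul {X : Ω → ℝ} (hX : ∀ i, Integrable X (μ i)) :
    ∫ ω, X ω ∂(∑ i, p i • μ i) = ∑ i, (p i).toReal * ∫ ω, X ω ∂μ i := by
  rw [integral_finsetSum_measure fun i _ => (hX i).smul_measure (p.apply_ne_top i)]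
  simp_rw [integral_smul_measure, smul_eq_mul]

end Mixture

section Measurability

variable {E : Type*} [MeasurableSpace E] {t : ℕ}

theorem measurable_finSnoc :
    Measurable fun x : (Fin t → E) × E => Fin.snoc (α := fun _ => E) x.1 x.2 := by
  refine measurable_pi_lambda _ fun i => ?_
  refine Fin.lastCases ?_ (fun i => ?_) i
  · simpa using measurable_snd
  · simpa [Function.comp_def] using (measurable_pi_apply i).comp measurable_fst

theorem measurable_finSnoc_right (x : Fin t → E) :
    Measurable (Fin.snoc (α := fun _ => E) x) :=
  measurable_finSnoc.comp measurable_prodMk_left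

theorem measurable_finCons :
    Measurable fun x : E × (Fin t → E) => Fin.cons (α := fun _ => E) x.1 x.2 := by
  refine measurable_pi_lambda _ fun i => ?_
  refine Fin.cases ?_ (fun i => ?_) i
  · simpa using measurable_fst
  · simpa [Function.comp_def] using (measurable_pi_apply i).comp measurable_snd

theorem measurable_cons_step {S A : Type*} [MeasurableSpace S] [MeasurableSpace A] (s : S) (a : A)
    (n : ℕ) :
    Measurable fun x : ℝ × (Fin n → S × A × ℝ) =>
      Fin.cons (α := fun _ => S × A × ℝ) (s, a, x.1) x.2 :=
  measurable_finCons.comp (by fun_prop : Measurable fun x : ℝ × (Fin n → S × A × ℝ) =>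
    ((s, a, x.1), x.2))

theorem measurable_comp_of_countable {Q X Y Z : Type*} [MeasurableSpace Q] [Countable Q]
    [MeasurableSingletonClass Q] [MeasurableSpace X] [MeasurableSpace Y] [MeasurableSpace Z]
    {f : Q → Y → Z} (hf : ∀ q, Measurable (f q)) {g : X → Q} (hg : Measurable g) {k : X → Y}
    (hk : Measurable k) : Measurable fun x => f (g x) (k x) :=
  (measurable_from_prod_countable_right (f := fun x : Q × Y => f x.1 x.2) hf).comp (hg.prodMk hk)

end Measurability

section Bellman

variable {S A : Type*} (P : S → A → PMF S) (s₀ : S) (π : S → A)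

theorem stateLaw_succ' (h : ℕ) :
    stateLaw P s₀ π (h + 1) = (P s₀ (π s₀)).bind fun s => stateLaw P s π h := by
  induction h with
  | zero => simp [stateLaw]
  | succ h ih =>
    rw [stateLaw, ih, PMF.bind_bind]
    rfl

variable [Fintype S]

theorem occ_succ' (h : ℕ) (s : S) :
    occ P s₀ π (h + 1) s = ∑ s', (P s₀ (π s₀) s').toReal * occ P s' π h s := by
  simp_rw [occ, stateLaw_succ', PMF.bind_apply, tsum_fintype, ← ENNReal.toReal_mul]
  exact ENNReal.toReal_sum fun s' _ =>
    ENNReal.mul_ne_top (PMF.apply_ne_top _ _) (PMF.apply_ne_top _ _)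

theorem value_succ (H : ℕ) (r : S → A → ℝ) :
    value (H + 1) P s₀ r π =
      r s₀ (π s₀) + ∑ s', (P s₀ (π s₀) s').toReal * value H P s' r π := by
  classical
  have hzero : ∑ s, occ P s₀ π 0 s * r s (π s) = r s₀ (π s₀) := by
    simp [occ, stateLaw, PMF.pure_apply, apply_ite]
  rw [value, Finset.sum_range_succ', hzero, add_comm]
  simp_rw [value, occ_succ', Finset.sum_mul, Finset.mul_sum, ← mul_assoc]
  rw [Finset.sum_comm (s := Finset.univ)]
  exact congrArg _ (Finset.sum_congr rfl fun _ _ => Finset.sum_comm)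

end Bellman

namespace LayeredCMDP

section Trajectory

variable {C S A : Type*} {H : ℕ} (M : LayeredCMDP C S A H)
  [Fintype S] [MeasurableSpace S] [MeasurableSpace A]

instance (c : C) (s : S) (a : A) : IsProbabilityMeasure (M.R c s a) := M.R_prob c s a

instance isProbabilityMeasure_trajLaw (c : C) (π : S → A) (n : ℕ) (s : S) :
    IsProbabilityMeasure (M.trajLaw c π n s) := by
  induction n generalizing s with
  | zero => exact Measure.dirac.isProbabilityMeasure
  | succ n ih =>
    have := isProbabilityMeasure_sum_smul (M.P c s (π s)) ih
    exact Measure.isProbabilityMeasure_map (measurable_cons_step s (π s) n).aemeasurable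

theorem ae_reward_mem_trajLaw (c : C) (π : S → A) (n : ℕ) (s : S) :
    ∀ᵐ τ ∂M.trajLaw c π n s, ∀ h, (τ h).2.2 ∈ Set.Icc (0 : ℝ) 1 := by
  induction n generalizing s with
  | zero => exact .of_forall fun _ h => h.elim0
  | succ n ih =>
    have hmeas : MeasurableSet
        {τ : Fin (n + 1) → S × A × ℝ | ∀ h, (τ h).2.2 ∈ Set.Icc (0 : ℝ) 1} := by
      rw [Set.ofPred_forall]
      exact .iInter fun h =>
        (by fun_prop : Measurable fun τ : Fin (n + 1) → S × A × ℝ => (τ h).2.2) measurableSet_Icc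
    rw [trajLaw, ae_map_iff (measurable_cons_step s (π s) n).aemeasurable hmeas]
    filter_upwards [Measure.quasiMeasurePreserving_fst.ae (M.R_support c s (π s)),
      Measure.quasiMeasurePreserving_snd.ae (ae_sum_smul (M.P c s (π s)) ih)] with x hfst hsnd
    exact Fin.forall_fin_succ.2 ⟨by simpa using hfst, by simpa using hsnd⟩

variable {g : S → A → ℝ → ℝ} {B : ℝ} (hg : Measurable fun x : S × A × ℝ => g x.1 x.2.1 x.2.2)
  (hB : ∀ s a, ∀ x ∈ Set.Icc (0 : ℝ) 1, |g s a x| ≤ B)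

include hg hB in
theorem integrable_sum_trajLaw (c : C) (π : S → A) (n : ℕ) (s : S) :
    Integrable (fun τ : Fin n → S × A × ℝ => ∑ h, g (τ h).1 (τ h).2.1 (τ h).2.2)
      (M.trajLaw c π n s) := by
  refine integrable_finsetSum _ fun h _ =>
    .of_bound (hg.comp (measurable_pi_apply h)).aestronglyMeasurable B ?_
  filter_upwards [M.ae_reward_mem_trajLaw c π n s] with τ hτ using hB _ _ _ (hτ h)

include hg hB in
theorem integral_sum_trajLaw (c : C) (π : S → A) (n : ℕ) (s : S) :
    ∫ τ, ∑ h, g (τ h).1 (τ h).2.1 (τ h).2.2 ∂M.trajLaw c π n s =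
      value n (M.P c) s (fun s a => ∫ x, g s a x ∂M.R c s a) π := by
  induction n generalizing s with
  | zero => simp [value]
  | succ n ih =>
    have := isProbabilityMeasure_sum_smul (M.P c s (π s))
      (M.isProbabilityMeasure_trajLaw c π n)
    have hfirst : Integrable (g s (π s)) (M.R c s (π s)) := by
      refine .of_bound (hg.comp (by fun_prop : Measurable fun x : ℝ => (s, π s, x))
        ).aestronglyMeasurable B ?_
      filter_upwards [M.R_support c s (π s)] with x hx using hB _ _ _ hx
    have hrest := M.integrable_sum_trajLaw hg hB c π n
    have hsum : Measurable fun τ : Fin (n + 1) → S × A × ℝ =>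
        ∑ h, g (τ h).1 (τ h).2.1 (τ h).2.2 :=
      Finset.measurable_fun_sum _ fun h _ => hg.comp (measurable_pi_apply h)
    rw [trajLaw, integral_map (measurable_cons_step s (π s) n).aemeasurable
      hsum.aestronglyMeasurable, value_succ]
    simp_rw [Fin.sum_univ_succ, Fin.cons_zero, Fin.cons_succ]
    rw [integral_add (hfirst.comp_fst _) ((integrable_sum_smul _ hrest).comp_snd _),
      integral_fun_fst, integral_fun_snd (fun τ : Fin n → S × A × ℝ =>
        ∑ h, g (τ h).1 (τ h).2.1 (τ h).2.2), integral_sum_smul _ hrest]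
    simp [ih]

end Trajectory

end LayeredCMDP

/-- The sum of `φ c s_h a_h r_h` over the steps `h` of an episode with context `c`. -/
def stepSum {C S A : Type*} {H : ℕ} (φ : C → S → A → ℝ → ℝ) (e : Episode C S A H) : ℝ :=
  ∑ h, φ e.1 (e.2 h).1 (e.2 h).2.1 (e.2 h).2.2

theorem measurable_stepSum {C S A : Type*} {H : ℕ} [Countable C] [Countable S] [Countable A]
    [MeasurableSpace C] [MeasurableSpace S] [MeasurableSpace A] [MeasurableSingletonClass C]
    [MeasurableSingletonClass S] [MeasurableSingletonClass A] {φ : C → S → A → ℝ → ℝ}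
    (hφ : ∀ c s a, Measurable (φ c s a)) : Measurable (stepSum φ : Episode C S A H → ℝ) :=
  Finset.measurable_fun_sum _ fun h _ =>
    measurable_comp_of_countable (f := fun q : C × S × A => φ q.1 q.2.1 q.2.2)
      (g := fun e : Episode C S A H => (e.1, (e.2 h).1, (e.2 h).2.1)) (fun q => hφ q.1 q.2.1 q.2.2)
      (by fun_prop) (by fun_prop)

namespace LayeredCMDP

section Context

variable {C S A : Type*} {H : ℕ} (M : LayeredCMDP C S A H) [Fintype C]

/-- The expectation of `k` under the context distribution. -/
noncomputable def ctxMean (k : C → ℝ) : ℝ := ∑ c, (M.ctxDist c).toReal * k c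

theorem ctxMean_mono {k k' : C → ℝ} (h : ∀ c, k c ≤ k' c) : M.ctxMean k ≤ M.ctxMean k' :=
  Finset.sum_le_sum fun c _ => mul_le_mul_of_nonneg_left (h c) ENNReal.toReal_nonneg

theorem ctxMean_const (b : ℝ) : M.ctxMean (fun _ => b) = b := by
  rw [ctxMean, ← Finset.sum_mul, sum_toReal_pmf, one_mul]

theorem ctxMean_add (k k' : C → ℝ) :
    M.ctxMean (fun c => k c + k' c) = M.ctxMean k + M.ctxMean k' := by
  simp only [ctxMean, mul_add, Finset.sum_add_distrib]

theorem ctxMean_const_mul (b : ℝ) (k : C → ℝ) :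
    M.ctxMean (fun c => b * k c) = b * M.ctxMean k := by
  simp only [ctxMean, Finset.mul_sum, mul_left_comm]

theorem ctxMean_sum {ι : Type*} (s : Finset ι) (k : ι → C → ℝ) :
    M.ctxMean (fun c => ∑ i ∈ s, k i c) = ∑ i ∈ s, M.ctxMean (k i) := by
  simp only [ctxMean, Finset.mul_sum]
  exact Finset.sum_comm

end Context

section Episode

variable {C S A : Type*} {H : ℕ} (M : LayeredCMDP C S A H) [Fintype C] [Fintype S]
  [MeasurableSpace C] [MeasurableSpace S] [MeasurableSpace A] (π : C → S → A)

instance isProbabilityMeasure_episodeLaw : IsProbabilityMeasure (M.episodeLaw π) :=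
  isProbabilityMeasure_sum_smul M.ctxDist fun _ =>
    Measure.isProbabilityMeasure_map measurable_prodMk_left.aemeasurable

theorem ae_reward_mem_episodeLaw :
    ∀ᵐ e ∂M.episodeLaw π, ∀ h, (e.2 h).2.2 ∈ Set.Icc (0 : ℝ) 1 := by
  have hmeas : MeasurableSet {e : Episode C S A H | ∀ h, (e.2 h).2.2 ∈ Set.Icc (0 : ℝ) 1} := by
    rw [Set.ofPred_forall]
    exact .iInter fun h =>
      (by fun_prop : Measurable fun e : Episode C S A H => (e.2 h).2.2) measurableSet_Icc
  refine ae_sum_smul M.ctxDist fun c => ?_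
  rw [ae_map_iff measurable_prodMk_left.aemeasurable hmeas]
  exact M.ae_reward_mem_trajLaw c (π c) H M.s₀

theorem integral_episodeLaw {X : Episode C S A H → ℝ} (hX : Measurable X)
    (hint : ∀ c, Integrable (fun τ => X (c, τ)) (M.trajLaw c (π c) H M.s₀)) :
    ∫ e, X e ∂M.episodeLaw π = M.ctxMean fun c => ∫ τ, X (c, τ) ∂M.trajLaw c (π c) H M.s₀ := by
  rw [episodeLaw, integral_sum_smul M.ctxDist fun c =>
    (integrable_map_measure hX.aestronglyMeasurable measurable_prodMk_left.aemeasurable).2 (hint c)]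
  exact Finset.sum_congr rfl fun c _ => by
    rw [integral_map measurable_prodMk_left.aemeasurable hX.aestronglyMeasurable]

theorem integral_context [MeasurableSingletonClass C] (k : C → ℝ) :
    ∫ e, k e.1 ∂M.episodeLaw π = M.ctxMean k := by
  rw [M.integral_episodeLaw π (X := fun e => k e.1)
    ((measurable_of_countable k).comp measurable_fst) fun c => integrable_const (k c)]
  simp

theorem ae_abs_stepSum_le {φ : C → S → A → ℝ → ℝ} {B : ℝ}
    (hB : ∀ c s a, ∀ x ∈ Set.Icc (0 : ℝ) 1, |φ c s a x| ≤ B) :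
    ∀ᵐ e ∂M.episodeLaw π, |stepSum φ e| ≤ H * B := by
  filter_upwards [M.ae_reward_mem_episodeLaw π] with e he
  refine (Finset.abs_sum_le_sum_abs _ _).trans ?_
  simpa using Finset.sum_le_card_nsmul _ _ B fun h (_ : h ∈ Finset.univ) => hB e.1 _ _ _ (he h)

variable [MeasurableSingletonClass C] [MeasurableSingletonClass S] [MeasurableSingletonClass A]
  [Countable A]

theorem integral_stepSum {φ : C → S → A → ℝ → ℝ} {B : ℝ} (hφ : ∀ c s a, Measurable (φ c s a))
    (hB : ∀ c s a, ∀ x ∈ Set.Icc (0 : ℝ) 1, |φ c s a x| ≤ B) :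
    ∫ e, stepSum φ e ∂M.episodeLaw π = M.ctxMean fun c =>
      value H (M.P c) M.s₀ (fun s a => ∫ x, φ c s a x ∂M.R c s a) (π c) := by
  have hstep (c : C) : Measurable fun x : S × A × ℝ => φ c x.1 x.2.1 x.2.2 :=
    measurable_comp_of_countable (f := fun q : S × A => φ c q.1 q.2)
      (g := fun x : S × A × ℝ => (x.1, x.2.1)) (fun q => hφ c q.1 q.2) (by fun_prop) (by fun_prop)
  rw [M.integral_episodeLaw π (measurable_stepSum hφ) fun c =>
    M.integrable_sum_trajLaw (hstep c) (hB c) c (π c) H M.s₀]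
  exact congrArg M.ctxMean <| funext fun c =>
    M.integral_sum_trajLaw (hstep c) (hB c) c (π c) H M.s₀

end Episode

end LayeredCMDP

/-! ### Deviation along histories -/

theorem integrable_add_sq {Ω : Type*} [MeasurableSpace Ω] {μ : Measure Ω} [IsFiniteMeasure μ]
    {X : Ω → ℝ} (hX : Measurable X) {B : ℝ} (hbound : ∀ᵐ ω ∂μ, |X ω| ≤ B) :
    Integrable (fun ω => X ω + X ω ^ 2) μ :=
  (Integrable.of_bound hX.aestronglyMeasurable B hbound).add <|
    .of_bound (by fun_prop) (B ^ 2) <| hbound.mono fun ω h => by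
      rw [Real.norm_eq_abs, abs_pow]
      gcongr

theorem lintegral_exp_sub_le_one {Ω : Type*} [MeasurableSpace Ω] {μ : Measure Ω}
    [IsProbabilityMeasure μ] {X : Ω → ℝ} (hX : Measurable X) (hbound : ∀ᵐ ω ∂μ, |X ω| ≤ 1) {v : ℝ}
    (hv : ∫ ω, (X ω + X ω ^ 2) ∂μ ≤ v) :
    ∫⁻ ω, ENNReal.ofReal (Real.exp (X ω - v)) ∂μ ≤ 1 := by
  have hint : Integrable (fun ω => 1 + (X ω + X ω ^ 2)) μ :=
    (integrable_const 1).add (integrable_add_sq hX hbound)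
  have hexp : ∀ᵐ ω ∂μ, Real.exp (X ω) ≤ 1 + (X ω + X ω ^ 2) := by
    filter_upwards [hbound] with ω hω
    linarith [(abs_le.1 (Real.abs_exp_sub_one_sub_id_le hω)).2]
  calc ∫⁻ ω, ENNReal.ofReal (Real.exp (X ω - v)) ∂μ
    _ ≤ ∫⁻ ω, ENNReal.ofReal (Real.exp (-v) * (1 + (X ω + X ω ^ 2))) ∂μ := by
        refine lintegral_mono_ae (hexp.mono fun ω hω => ENNReal.ofReal_le_ofReal ?_)
        rw [sub_eq_neg_add, Real.exp_add]
        gcongr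
    _ = ENNReal.ofReal (Real.exp (-v) * (1 + ∫ ω, (X ω + X ω ^ 2) ∂μ)) := by
        rw [← ofReal_integral_eq_lintegral_ofReal (hint.const_mul _), integral_const_mul,
          integral_add (integrable_const 1) (integrable_add_sq hX hbound)]
        · simp
        · exact hexp.mono fun ω hω =>
            mul_nonneg (Real.exp_nonneg _) ((Real.exp_nonneg _).trans hω)
    _ ≤ ENNReal.ofReal (Real.exp (-v) * Real.exp v) := by
        gcongr
        linarith [Real.add_one_le_exp v]
    _ = 1 := by rw [← Real.exp_add, neg_add_cancel, Real.exp_zero, ENNReal.ofReal_one]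

theorem Hist.measurable_pre {C S A : Type*} [MeasurableSpace C] [MeasurableSpace S]
    [MeasurableSpace A] {H t : ℕ} (i : Fin t) :
    Measurable fun hist : Hist C S A H t => hist.pre i :=
  measurable_pi_lambda _ fun _ => measurable_pi_apply _

theorem Hist.pre_snoc_last {C S A : Type*} {H t : ℕ} (hist : Hist C S A H t)
    (e : Episode C S A H) :
    Hist.pre (Fin.snoc (α := fun _ => Episode C S A H) hist e : Hist C S A H (t + 1))
      (Fin.last t) = hist :=
  funext fun j => Fin.snoc_castSucc (α := fun _ => Episode C S A H) e hist j

/-- The policy that the learner `π` plays in round `t` of the history `hist`. -/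
def played {C S A : Type*} {H : ℕ} (π : (i : ℕ) → Hist C S A H i → C → S → A) {T : ℕ}
    (hist : Hist C S A H T) (t : Fin T) : C → S → A :=
  π t (hist.pre t)

theorem measurable_played {C S A : Type*} [MeasurableSpace C] [MeasurableSpace S]
    [MeasurableSpace A] {H : ℕ} {π : (i : ℕ) → Hist C S A H i → C → S → A}
    (hπ : ∀ t, Measurable (π t)) {T : ℕ} (t : Fin T) :
    Measurable fun hist : Hist C S A H T => played π hist t :=
  (hπ t).comp (Hist.measurable_pre t)

theorem measurable_prod_played {C S A : Type*} [Finite C] [Finite S] [Countable A]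
    [MeasurableSpace C] [MeasurableSpace S] [MeasurableSpace A] [MeasurableSingletonClass A]
    {H : ℕ} {π : (i : ℕ) → Hist C S A H i → C → S → A} (hπ : ∀ t, Measurable (π t))
    {ψ : (C → S → A) → Episode C S A H → ENNReal} (hψ : ∀ q, Measurable (ψ q)) (T : ℕ) :
    Measurable fun hist : Hist C S A H T => ∏ t, ψ (played π hist t) (hist t) :=
  Finset.measurable_fun_prod _ fun t _ =>
    measurable_comp_of_countable hψ (measurable_played hπ t) (measurable_pi_apply t)

namespace LayeredCMDP

section History

variable {C S A : Type*} {H : ℕ} (M : LayeredCMDP C S A H) [Fintype C] [Fintype S] [Countable A]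
  [MeasurableSpace C] [MeasurableSpace S] [MeasurableSpace A] [MeasurableSingletonClass A]
  {π : (i : ℕ) → Hist C S A H i → C → S → A} (hπ : ∀ t, Measurable (π t))

include hπ

theorem measurable_episodeLaw_snoc (t : ℕ) :
    Measurable fun hist : Hist C S A H t =>
      (M.episodeLaw (π t hist)).map (Fin.snoc (α := fun _ => Episode C S A H) hist) := by
  refine Measure.measurable_of_measurable_coe _ fun B hB => ?_
  simp_rw [Measure.map_apply (measurable_finSnoc_right _) hB]
  exact measurable_comp_of_countable (f := fun (q : C → S → A) (hist : Hist C S A H t) =>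
      M.episodeLaw q (Fin.snoc (α := fun _ => Episode C S A H) hist ⁻¹' B))
    (fun _ => measurable_measure_prodMk_left (measurable_finSnoc hB)) (hπ t) measurable_id

theorem isProbabilityMeasure_histLaw (t : ℕ) : IsProbabilityMeasure (M.histLaw π t) := by
  induction t with
  | zero => exact Measure.dirac.isProbabilityMeasure
  | succ t ih =>
    exact isProbabilityMeasure_bind (M.measurable_episodeLaw_snoc hπ t).aemeasurable <|
      .of_forall fun hist =>
        Measure.isProbabilityMeasure_map (measurable_finSnoc_right hist).aemeasurable

theorem map_pre_last_histLaw (t : ℕ) :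
    (M.histLaw π (t + 1)).map (fun hist => hist.pre (Fin.last t)) = M.histLaw π t := by
  have hpre (hist : Hist C S A H t) :
      ((M.episodeLaw (π t hist)).map (Fin.snoc (α := fun _ => Episode C S A H) hist)).map
        (fun hist' : Hist C S A H (t + 1) => hist'.pre (Fin.last t)) = Measure.dirac hist := by
    rw [Measure.map_map (Hist.measurable_pre _) (measurable_finSnoc_right _)]
    simp [Function.comp_def, Hist.pre_snoc_last]
  ext B hB
  rw [Measure.map_apply (Hist.measurable_pre _) hB, histLaw,
    Measure.bind_apply (Hist.measurable_pre _ hB) (M.measurable_episodeLaw_snoc hπ t).aemeasurable]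
  simp_rw [← Measure.map_apply (Hist.measurable_pre (Fin.last t)) hB]
  simp [hpre, hB]

theorem map_pre_histLaw {T : ℕ} (t : Fin T) :
    (M.histLaw π T).map (fun hist => hist.pre t) = M.histLaw π t := by
  induction T with
  | zero => exact t.elim0
  | succ T ih =>
    refine Fin.lastCases (M.map_pre_last_histLaw hπ T) (fun t => ?_) t
    refine Eq.trans ?_ (ih t)
    rw [← M.map_pre_last_histLaw hπ T,
      Measure.map_map (Hist.measurable_pre t) (Hist.measurable_pre _)]
    rfl

theorem lintegral_prod_played_le_one {ψ : (C → S → A) → Episode C S A H → ENNReal}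
    (hψ : ∀ q, Measurable (ψ q)) (hψ_le : ∀ q, ∫⁻ e, ψ q e ∂M.episodeLaw q ≤ 1) (T : ℕ) :
    ∫⁻ hist, ∏ t, ψ (played π hist t) (hist t) ∂M.histLaw π T ≤ 1 := by
  induction T with
  | zero => simp [histLaw]
  | succ T ih =>
    have hsnoc (hist : Hist C S A H T) (e : Episode C S A H) :
        (∏ t : Fin (T + 1), ψ (played π (Fin.snoc (α := fun _ => Episode C S A H) hist e) t)
          (Fin.snoc (α := fun _ => Episode C S A H) hist e t)) =
        (∏ t, ψ (played π hist t) (hist t)) * ψ (π T hist) e := by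
      have hpre : Hist.pre (Fin.snoc (α := fun _ => Episode C S A H) hist e) (Fin.last T) = hist :=
        Hist.pre_snoc_last hist e
      have hlast : played π (Fin.snoc (α := fun _ => Episode C S A H) hist e) (Fin.last T) =
          π T hist := congrArg (π T) hpre
      have hinit (t : Fin T) : played π (Fin.snoc (α := fun _ => Episode C S A H) hist e)
          t.castSucc = played π hist t := congrArg (fun h : Hist C S A H T => π t (h.pre t)) hpre
      simp_rw [Fin.prod_univ_castSucc, hlast, hinit, Fin.snoc_last, Fin.snoc_castSucc]
    rw [histLaw, Measure.lintegral_bind (M.measurable_episodeLaw_snoc hπ T).aemeasurable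
      (measurable_prod_played hπ hψ _).aemeasurable]
    refine (lintegral_mono fun hist => ?_).trans ih
    rw [lintegral_map (measurable_prod_played hπ hψ _) (measurable_finSnoc_right _)]
    simp_rw [hsnoc]
    rw [lintegral_const_mul _ (hψ _)]
    exact mul_le_of_le_one_right zero_le (hψ_le _)

theorem histLaw_deviation_le {X : (C → S → A) → Episode C S A H → ℝ} {v : (C → S → A) → ℝ}
    (hX : ∀ q, Measurable (X q)) (hbound : ∀ q, ∀ᵐ e ∂M.episodeLaw q, |X q e| ≤ 1)
    (hv : ∀ q, ∫ e, (X q e + X q e ^ 2) ∂M.episodeLaw q ≤ v q) (T : ℕ) {ε : ℝ} (hε : 0 < ε) :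
    M.histLaw π T {hist | Real.log (1 / ε) <
      ∑ t, (X (played π hist t) (hist t) - v (played π hist t))} ≤ ENNReal.ofReal ε := by
  let ψ (q : C → S → A) (e : Episode C S A H) : ENNReal := ENNReal.ofReal (Real.exp (X q e - v q))
  have hψ (q : C → S → A) : Measurable (ψ q) := by fun_prop
  have hmean := M.lintegral_prod_played_le_one hπ hψ
    (fun q => lintegral_exp_sub_le_one (hX q) (hbound q) (hv q)) T
  have hε' : 0 < ENNReal.ofReal (1 / ε) := ENNReal.ofReal_pos.2 (by positivity)
  calc M.histLaw π T {hist | Real.log (1 / ε) <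
        ∑ t, (X (played π hist t) (hist t) - v (played π hist t))}
    _ ≤ M.histLaw π T {hist | ENNReal.ofReal (1 / ε) ≤ ∏ t, ψ (played π hist t) (hist t)} := by
        refine measure_mono fun hist (h : Real.log (1 / ε) < _) => ?_
        change ENNReal.ofReal (1 / ε) ≤ ∏ t, ψ _ _
        rw [← ENNReal.ofReal_prod_of_nonneg fun _ _ => Real.exp_nonneg _, ← Real.exp_sum]
        exact ENNReal.ofReal_le_ofReal ((Real.log_le_iff_le_exp (by positivity)).1 h.le)
    _ ≤ (∫⁻ hist, ∏ t, ψ (played π hist t) (hist t) ∂M.histLaw π T) / ENNReal.ofReal (1 / ε) :=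
        meas_ge_le_lintegral_div (measurable_prod_played hπ hψ T).aemeasurable hε'.ne'
          ENNReal.ofReal_ne_top
    _ ≤ 1 / ENNReal.ofReal (1 / ε) := by gcongr
    _ = ENNReal.ofReal ε := by
        rw [one_div, one_div, ENNReal.ofReal_inv_of_pos hε, inv_inv]

end History

end LayeredCMDP

/-! ### Excess loss and suboptimality -/

theorem integral_sq_sub_sub_sq_integral_sub {μ : Measure ℝ} [IsProbabilityMeasure μ]
    (hμ : Integrable (fun x => x) μ) (a : ℝ) :
    ∫ x, ((a - x) ^ 2 - (∫ y, y ∂μ - x) ^ 2) ∂μ = (a - ∫ y, y ∂μ) ^ 2 := by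
  set b := ∫ y, y ∂μ with hb
  have hlin (x : ℝ) : (a - x) ^ 2 - (b - x) ^ 2 = (a ^ 2 - b ^ 2) - 2 * (a - b) * x := by ring
  simp_rw [hlin]
  rw [integral_sub (integrable_const _) (hμ.const_mul _), integral_const_mul, ← hb]
  simp only [integral_const, probReal_univ, one_smul]
  ring

theorem abs_sq_sub_sub_sq_sub_le_one {a b x : ℝ} (ha : a ∈ Set.Icc (0 : ℝ) 1)
    (hb : b ∈ Set.Icc (0 : ℝ) 1) (hx : x ∈ Set.Icc (0 : ℝ) 1) :
    |(a - x) ^ 2 - (b - x) ^ 2| ≤ 1 := by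
  have hsq {c : ℝ} (hc : c ∈ Set.Icc (0 : ℝ) 1) : (c - x) ^ 2 ∈ Set.Icc (0 : ℝ) 1 :=
    ⟨sq_nonneg _, (sq_le_one_iff_abs_le_one _).2 <| by
      simpa using abs_sub_le_of_le_of_le hc.1 hc.2 hx.1 hx.2⟩
  simpa using abs_sub_le_of_le_of_le (hsq ha).1 (hsq ha).2 (hsq hb).1 (hsq hb).2

theorem sq_sq_sub_sub_sq_sub_le {a b x : ℝ} (ha : a ∈ Set.Icc (0 : ℝ) 1)
    (hb : b ∈ Set.Icc (0 : ℝ) 1) (hx : x ∈ Set.Icc (0 : ℝ) 1) :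
    ((a - x) ^ 2 - (b - x) ^ 2) ^ 2 ≤ 4 * (a - b) ^ 2 := by
  have hfactor : (a + b - 2 * x) ^ 2 ≤ 2 ^ 2 :=
    sq_le_sq' (by linarith [ha.1, hb.1, hx.2]) (by linarith [ha.2, hb.2, hx.1])
  calc ((a - x) ^ 2 - (b - x) ^ 2) ^ 2
    _ = (a + b - 2 * x) ^ 2 * (a - b) ^ 2 := by ring
    _ ≤ 2 ^ 2 * (a - b) ^ 2 := by gcongr
    _ = 4 * (a - b) ^ 2 := by ring

/-- The squared loss of `f` minus the squared loss of `g` on one episode. -/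
def excessLoss {C S A : Type*} {H : ℕ} (f g : C → S → A → ℝ) : Episode C S A H → ℝ :=
  stepSum fun c s a x => (f c s a - x) ^ 2 - (g c s a - x) ^ 2

theorem sqLoss_sub_sqLoss {C S A : Type*} {H t : ℕ} (f g : C → S → A → ℝ)
    (hist : Hist C S A H t) : sqLoss f hist - sqLoss g hist = ∑ i, excessLoss f g (hist i) := by
  simp only [sqLoss, excessLoss, stepSum, Finset.sum_sub_distrib]

namespace LayeredCMDP

section Rewards

variable {C S A : Type*} {H : ℕ} (M : LayeredCMDP C S A H)

theorem integrable_reward (c : C) (s : S) (a : A) : Integrable (fun x => x) (M.R c s a) :=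
  .of_bound measurable_id.aestronglyMeasurable 1 <| (M.R_support c s a).mono fun x hx => by
    rw [Real.norm_eq_abs, abs_of_nonneg hx.1]
    exact hx.2

theorem meanReward_mem (c : C) (s : S) (a : A) : M.meanReward c s a ∈ Set.Icc (0 : ℝ) 1 :=
  (convex_Icc 0 1).integral_mem isClosed_Icc (M.R_support c s a) (M.integrable_reward c s a)

/-- `g` gives the mean rewards, except possibly in the terminal state, where nothing is
collected. -/
def IsRewardModel (g : C → S → A → ℝ) : Prop :=
  ∀ c s a, s ≠ M.sH → g c s a = M.meanReward c s a

variable {M} in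
theorem Realizable.nonempty {F : Finset (C → S → A → ℝ)} (hF : M.Realizable F) : F.Nonempty :=
  let ⟨g, hg, _⟩ := hF
  ⟨g, hg⟩

variable [Fintype S]

theorem IsRewardModel.value_eq {M : LayeredCMDP C S A H} {g : C → S → A → ℝ}
    (hg : M.IsRewardModel g) (c : C) (π : S → A) :
    value H (M.P c) M.s₀ (g c) π = M.trueValue c π :=
  M.value_congr fun s hs => hg c s (π s) hs

/-- The suboptimality of `π` with respect to `πs` in context `c`. -/
noncomputable def gap (πs π : C → S → A) (c : C) : ℝ :=
  M.trueValue c (πs c) - M.trueValue c (π c)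

theorem gap_nonneg {πs : C → S → A} (hπs : M.IsOptimal πs) (π : C → S → A) (c : C) :
    0 ≤ M.gap πs π c := sub_nonneg.2 (hπs c (π c))

theorem gap_le (πs π : C → S → A) (c : C) : M.gap πs π c ≤ H :=
  (sub_le_self _ (M.value_nonneg fun s _ => (M.meanReward_mem c s _).1)).trans
    (M.value_le fun s _ => (M.meanReward_mem c s _).2)

theorem regret_eq_sum_gap (πs : C → S → A) (π : (i : ℕ) → Hist C S A H i → C → S → A) {T : ℕ}
    (hist : Hist C S A H T) :
    M.regret πs π hist = ∑ t, M.gap πs (played π hist t) (hist t).1 := rfl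

theorem regret_le (πs : C → S → A) (π : (i : ℕ) → Hist C S A H i → C → S → A) {T : ℕ}
    (hist : Hist C S A H T) : M.regret πs π hist ≤ T * H := by
  simpa [regret_eq_sum_gap] using Finset.sum_le_card_nsmul Finset.univ
    (fun t => M.gap πs (played π hist t) (hist t).1) H fun t _ => M.gap_le _ _ _

end Rewards

section Moments

variable {C S A : Type*} {H : ℕ} (M : LayeredCMDP C S A H) [Fintype C] [Fintype S]

/-- The expected suboptimality of `π` with respect to `πs`. -/
noncomputable def meanGap (πs π : C → S → A) : ℝ := M.ctxMean (M.gap πs π)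

theorem meanGap_nonneg {πs : C → S → A} (hπs : M.IsOptimal πs) (π : C → S → A) :
    0 ≤ M.meanGap πs π :=
  (M.ctxMean_const 0).symm.trans_le (M.ctxMean_mono fun c => M.gap_nonneg hπs π c)

theorem meanGap_le (πs π : C → S → A) : M.meanGap πs π ≤ H :=
  (M.ctxMean_mono fun c => M.gap_le πs π c).trans_eq (M.ctxMean_const _)

/-- The expected squared distance of `f` and `g` along an episode of the policy `π`. -/
noncomputable def sqError (f g : C → S → A → ℝ) (π : C → S → A) : ℝ :=
  M.ctxMean fun c => value H (M.P c) M.s₀ (fun s a => (f c s a - g c s a) ^ 2) (π c)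

variable [MeasurableSpace C] [MeasurableSpace S] [MeasurableSpace A]
  {f g : C → S → A → ℝ} (hf : ∀ c s a, f c s a ∈ Set.Icc (0 : ℝ) 1)
  (hg : ∀ c s a, g c s a ∈ Set.Icc (0 : ℝ) 1) (π : C → S → A)

include hf hg

theorem ae_abs_excessLoss_le : ∀ᵐ e ∂M.episodeLaw π, |excessLoss f g e| ≤ H := by
  simpa [excessLoss] using M.ae_abs_stepSum_le π
    (φ := fun c s a x => (f c s a - x) ^ 2 - (g c s a - x) ^ 2)
    fun c s a x => abs_sq_sub_sub_sq_sub_le_one (hf c s a) (hg c s a)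

theorem ae_sq_excessLoss_le : ∀ᵐ e ∂M.episodeLaw π,
    excessLoss f g e ^ 2 ≤ 4 * H * stepSum (fun c s a _ => (f c s a - g c s a) ^ 2) e := by
  filter_upwards [M.ae_reward_mem_episodeLaw π] with e he
  calc excessLoss f g e ^ 2
    _ ≤ H * ∑ h, ((f e.1 (e.2 h).1 (e.2 h).2.1 - (e.2 h).2.2) ^ 2 -
          (g e.1 (e.2 h).1 (e.2 h).2.1 - (e.2 h).2.2) ^ 2) ^ 2 := by
        simpa using! sq_sum_le_card_mul_sum_sq (s := (Finset.univ : Finset (Fin H)))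
    _ ≤ H * ∑ h, 4 * (f e.1 (e.2 h).1 (e.2 h).2.1 - g e.1 (e.2 h).1 (e.2 h).2.1) ^ 2 := by
        gcongr with h
        exact sq_sq_sub_sub_sq_sub_le (hf _ _ _) (hg _ _ _) (he h)
    _ = 4 * H * stepSum (fun c s a _ => (f c s a - g c s a) ^ 2) e := by
        rw [stepSum, ← Finset.mul_sum]
        ring

variable [MeasurableSingletonClass C] [MeasurableSingletonClass S] [MeasurableSingletonClass A]
  [Countable A]

theorem integral_excessLoss (hgM : M.IsRewardModel g) :
    ∫ e, excessLoss f g e ∂M.episodeLaw π = M.sqError f g π := by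
  rw [excessLoss, M.integral_stepSum π (fun c s a => by fun_prop)
    fun c s a x => abs_sq_sub_sub_sq_sub_le_one (hf c s a) (hg c s a)]
  refine congrArg M.ctxMean <| funext fun c => M.value_congr fun s hs => ?_
  rw [hgM c s _ hs]
  exact integral_sq_sub_sub_sq_integral_sub (M.integrable_reward c s _) _

theorem integral_sq_excessLoss_le :
    ∫ e, excessLoss f g e ^ 2 ∂M.episodeLaw π ≤ 4 * H * M.sqError f g π := by
  let φ : C → S → A → ℝ → ℝ := fun c s a _ => (f c s a - g c s a) ^ 2
  have hφ : ∀ c s a, Measurable (φ c s a) := fun c s a => measurable_const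
  have hφ_le (c : C) (s : S) (a : A) (x : ℝ) (_ : x ∈ Set.Icc (0 : ℝ) 1) : |φ c s a x| ≤ 1 := by
    rw [abs_pow, sq_abs, sq_le_one_iff_abs_le_one]
    simpa using abs_sub_le_of_le_of_le (hf c s a).1 (hf c s a).2 (hg c s a).1 (hg c s a).2
  have hint : Integrable (fun e => 4 * H * stepSum φ e) (M.episodeLaw π) :=
    .const_mul (.of_bound (measurable_stepSum hφ).aestronglyMeasurable _
      (M.ae_abs_stepSum_le π hφ_le)) _
  refine (integral_mono_of_nonneg (.of_forall fun e => sq_nonneg _) hint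
    (M.ae_sq_excessLoss_le hf hg π)).trans_eq ?_
  rw [integral_const_mul, M.integral_stepSum π hφ hφ_le]
  simp [φ, sqError]

theorem integral_neg_excessLoss_div_le (hgM : M.IsRewardModel g) :
    ∫ e, (-excessLoss f g e / (8 * H) + (-excessLoss f g e / (8 * H)) ^ 2) ∂M.episodeLaw π ≤
      -M.sqError f g π / (16 * H) := by
  rcases H.eq_zero_or_pos with rfl | hH
  · simp
  have hmeas : Measurable (excessLoss f g : Episode C S A H → ℝ) :=
    measurable_stepSum fun c s a => by fun_prop
  have hint : Integrable (fun e => -excessLoss f g e) (M.episodeLaw π) :=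
    (Integrable.of_bound hmeas.aestronglyMeasurable _ (M.ae_abs_excessLoss_le hf hg π)).neg
  have hint_sq : Integrable (fun e => excessLoss f g e ^ 2) (M.episodeLaw π) :=
    .of_bound (by fun_prop) ((H : ℝ) ^ 2) <| (M.ae_abs_excessLoss_le hf hg π).mono fun e he => by
      rw [Real.norm_eq_abs, abs_pow]
      gcongr
  simp_rw [div_pow, neg_sq]
  rw [integral_add (hint.div_const _) (hint_sq.div_const _), integral_div, integral_div,
    integral_neg, M.integral_excessLoss hf hg π hgM]
  -- The scale `8 * H` is chosen so that the second moment eats up half of the mean.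
  calc -M.sqError f g π / (8 * H) + (∫ e, excessLoss f g e ^ 2 ∂M.episodeLaw π) / (8 * H) ^ 2
    _ ≤ -M.sqError f g π / (8 * H) + 4 * H * M.sqError f g π / (8 * H) ^ 2 := by
        gcongr
        exact M.integral_sq_excessLoss_le hf hg π
    _ = -M.sqError f g π / (16 * H) := by
        field_simp
        ring

end Moments

section Confidence

variable {C S A : Type*} {H : ℕ} (M : LayeredCMDP C S A H) [Fintype C] [Fintype S]

/-- The histories along which, after every round, the squared error of every `f ∈ F` on the policies
played so far is at most twice its excess squared loss over `g`, up to `16 H Λ`. -/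
def lsqConfidence (π : (i : ℕ) → Hist C S A H i → C → S → A) (F : Finset (C → S → A → ℝ))
    (g : C → S → A → ℝ) (Λ : ℝ) (T : ℕ) : Set (Hist C S A H T) :=
  {hist | ∀ t : Fin T, ∀ f ∈ F, ∑ i, M.sqError f g (played π (hist.pre t) i) ≤
    2 * (sqLoss f (hist.pre t) - sqLoss g (hist.pre t)) + 16 * H * Λ}

variable [Countable A] [MeasurableSpace C] [MeasurableSpace S] [MeasurableSpace A]
  [MeasurableSingletonClass C] [MeasurableSingletonClass A]
  {π : (i : ℕ) → Hist C S A H i → C → S → A} (hπ : ∀ t, Measurable (π t))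

include hπ

theorem histLaw_regret_le {πs : C → S → A} (hπs : M.IsOptimal πs) (T : ℕ) {ε : ℝ} (hε : 0 < ε) :
    M.histLaw π T {hist | 2 * ∑ t, M.meanGap πs (played π hist t) + H * Real.log (1 / ε) <
      M.regret πs π hist} ≤ ENNReal.ofReal ε := by
  rcases H.eq_zero_or_pos with rfl | hH
  · simp [regret, trueValue, meanGap, gap, ctxMean, value]
  have hnonneg (q : C → S → A) (c : C) : 0 ≤ M.gap πs q c / H :=
    div_nonneg (M.gap_nonneg hπs q c) H.cast_nonneg
  have hle_one (q : C → S → A) (c : C) : M.gap πs q c / H ≤ 1 :=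
    div_le_one_of_le₀ (M.gap_le πs q c) H.cast_nonneg
  have hmean (q : C → S → A) :
      ∫ e, (M.gap πs q e.1 / H + (M.gap πs q e.1 / H) ^ 2) ∂M.episodeLaw q ≤
        2 / H * M.meanGap πs q := by
    rw [M.integral_context q fun c => M.gap πs q c / H + (M.gap πs q c / H) ^ 2, meanGap,
      ← M.ctxMean_const_mul]
    refine M.ctxMean_mono fun c => ?_
    rw [div_mul_eq_mul_div, mul_div_assoc]
    linarith [pow_le_of_le_one (hnonneg q c) (hle_one q c) two_ne_zero]
  refine (measure_mono fun hist hhist => ?_).trans <| M.histLaw_deviation_le hπ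
    (X := fun q e => M.gap πs q e.1 / H) (v := fun q => 2 / H * M.meanGap πs q)
    (fun q => (measurable_of_countable fun c => M.gap πs q c / H).comp measurable_fst)
    (fun q => .of_forall fun e => by
      rw [abs_of_nonneg (hnonneg q e.1)]
      exact hle_one q e.1)
    hmean T hε
  rw [Set.mem_ofPred_eq, regret_eq_sum_gap] at hhist
  rw [Set.mem_ofPred_eq, Finset.sum_sub_distrib, ← Finset.sum_div, ← Finset.mul_sum]
  field_simp
  linarith

theorem histLaw_regret_sqrt_le {πs : C → S → A} (hπs : M.IsOptimal πs) (T : ℕ) {ε : ℝ}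
    (hε : 0 < ε) :
    M.histLaw π T {hist | 2 * ∑ t, M.meanGap πs (played π hist t) + H * √(T * Real.log (1 / ε)) <
      M.regret πs π hist} ≤ ENNReal.ofReal ε := by
  refine (measure_mono fun hist hhist => ?_).trans <| M.histLaw_regret_le hπ hπs T hε
  rw [Set.mem_ofPred_eq] at hhist ⊢
  set L := Real.log (1 / ε)
  rcases le_total L T with hL | hL
  · have hsqrt : L ≤ √(T * L) := by
      rcases le_total L 0 with hL0 | hL0
      · exact hL0.trans (Real.sqrt_nonneg _)
      · exact Real.le_sqrt_of_sq_le (by nlinarith)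
    refine hhist.trans_le' ?_
    gcongr
  · have hsqrt : (T : ℝ) ≤ √(T * L) := Real.le_sqrt_of_sq_le (by nlinarith [T.cast_nonneg (α := ℝ)])
    have hsum : 0 ≤ ∑ t, M.meanGap πs (played π hist t) :=
      Finset.sum_nonneg fun t _ => M.meanGap_nonneg hπs _
    nlinarith [M.regret_le πs π hist, H.cast_nonneg (α := ℝ)]

variable [MeasurableSingletonClass S]

theorem histLaw_sqError_le {f g : C → S → A → ℝ}
    (hf : ∀ c s a, f c s a ∈ Set.Icc (0 : ℝ) 1) (hg : ∀ c s a, g c s a ∈ Set.Icc (0 : ℝ) 1)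
    (hgM : M.IsRewardModel g) (t : ℕ) {ε : ℝ} (hε : 0 < ε) :
    M.histLaw π t {hist | 2 * (sqLoss f hist - sqLoss g hist) + 16 * H * Real.log (1 / ε) <
      ∑ i, M.sqError f g (played π hist i)} ≤ ENNReal.ofReal ε := by
  rcases H.eq_zero_or_pos with rfl | hH
  · simp [sqLoss, sqError, ctxMean, value]
  refine (measure_mono fun hist hhist => ?_).trans <| M.histLaw_deviation_le hπ
    (X := fun _ e => -excessLoss f g e / (8 * H)) (v := fun q => -M.sqError f g q / (16 * H))
    (fun _ => by
      have : Measurable (excessLoss f g : Episode C S A H → ℝ) :=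
        measurable_stepSum fun c s a => by fun_prop
      fun_prop)
    (fun q => (M.ae_abs_excessLoss_le hf hg q).mono fun e he => by
      rw [abs_div, abs_neg, abs_of_nonneg (by positivity : (0 : ℝ) ≤ 8 * H)]
      exact div_le_one_of_le₀ (by linarith [(Nat.cast_nonneg H : (0 : ℝ) ≤ H)]) (by positivity))
    (M.integral_neg_excessLoss_div_le hf hg · hgM) t hε
  rw [Set.mem_ofPred_eq, sqLoss_sub_sqLoss] at hhist
  rw [Set.mem_ofPred_eq, Finset.sum_sub_distrib, ← Finset.sum_div, ← Finset.sum_div,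
    Finset.sum_neg_distrib, Finset.sum_neg_distrib]
  field_simp
  linarith

theorem histLaw_compl_lsqConfidence_le {F : Finset (C → S → A → ℝ)} {g : C → S → A → ℝ}
    (hF : ∀ f ∈ F, ∀ c s a, f c s a ∈ Set.Icc (0 : ℝ) 1)
    (hg : ∀ c s a, g c s a ∈ Set.Icc (0 : ℝ) 1) (hgM : M.IsRewardModel g) (T : ℕ) {ε : ℝ}
    (hε : 0 < ε) :
    M.histLaw π T (M.lsqConfidence π F g (Real.log (1 / ε)) T)ᶜ ≤
      ENNReal.ofReal (T * F.card * ε) := by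
  let bad (t : ℕ) (f : C → S → A → ℝ) : Set (Hist C S A H t) :=
    {hist | 2 * (sqLoss f hist - sqLoss g hist) + 16 * H * Real.log (1 / ε) <
      ∑ i, M.sqError f g (played π hist i)}
  have hcover : (M.lsqConfidence π F g (Real.log (1 / ε)) T)ᶜ ⊆
      ⋃ t : Fin T, ⋃ f ∈ F, (fun hist => hist.pre t) ⁻¹' bad t f := fun hist hhist => by
    simpa [lsqConfidence, bad] using! hhist
  have hbad (t : Fin T) (f) (hf : f ∈ F) :
      M.histLaw π T ((fun hist => hist.pre t) ⁻¹' bad t f) ≤ ENNReal.ofReal ε :=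
    calc M.histLaw π T ((fun hist => hist.pre t) ⁻¹' bad t f)
      _ ≤ (M.histLaw π T).map (fun hist => hist.pre t) (bad t f) :=
          Measure.le_map_apply (Hist.measurable_pre t).aemeasurable _
      _ ≤ ENNReal.ofReal ε := by
          rw [M.map_pre_histLaw hπ t]
          exact M.histLaw_sqError_le hπ (hF f hf) hg hgM t hε
  calc M.histLaw π T (M.lsqConfidence π F g (Real.log (1 / ε)) T)ᶜ
    _ ≤ ∑ t : Fin T, M.histLaw π T (⋃ f ∈ F, (fun hist => hist.pre t) ⁻¹' bad t f) :=
        (measure_mono hcover).trans (measure_iUnion_fintype_le _ _)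
    _ ≤ ∑ _t : Fin T, ∑ _f ∈ F, ENNReal.ofReal ε :=
        Finset.sum_le_sum fun t _ =>
          (measure_biUnion_finset_le F _).trans (Finset.sum_le_sum (hbad t))
    _ = ENNReal.ofReal (T * F.card * ε) := by
        rw [mul_assoc, ENNReal.ofReal_mul (by positivity), ENNReal.ofReal_mul (by positivity)]
        simp

end Confidence

end LayeredCMDP

/-! ### Regret of RM-KD -/

namespace LayeredCMDP

section Optimism

variable {C S A : Type*} {H : ℕ} (M : LayeredCMDP C S A H) [Fintype C] [Fintype S]

/-- The expected inverse weight of the state-action pairs along an episode of `π`, which is the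
expected bonus for the parameter `b = 1`. -/
noncomputable def meanBonus {t : ℕ} (past : Fin t → C → S → A) (π : C → S → A) : ℝ :=
  M.ctxMean fun c => value H (M.P c) M.s₀ (fun s a => (M.weight past c s a)⁻¹) (π c)

theorem meanBonus_nonneg {t : ℕ} (past : Fin t → C → S → A) (π : C → S → A) :
    0 ≤ M.meanBonus past π :=
  (M.ctxMean_const 0).symm.trans_le <| M.ctxMean_mono fun c =>
    M.value_nonneg fun _ _ => inv_nonneg.2 (M.weight_nonneg past c _ _)

variable {M}

theorem MinReach.sum_meanBonus_le [Fintype A] {p : ℝ} (hM : M.MinReach p) (hp : 0 < p) {T : ℕ}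
    (π : Fin T → C → S → A) :
    ∑ t : Fin T, M.meanBonus (Fin.take t t.2.le π) (π t) ≤
      p⁻¹ * (Fintype.card S * (Fintype.card A * (1 + Real.log T))) := by
  simp only [meanBonus]
  rw [← M.ctxMean_sum]
  exact (M.ctxMean_mono fun c => hM.sum_value_weight_inv_le π hp c).trans_eq (M.ctxMean_const _)

theorem IsOptimisticPolicy.meanGap_le {t : ℕ} {past : Fin t → C → S → A} {f g : C → S → A → ℝ}
    {b : ℝ} {π : C → S → A} (hπ : M.IsOptimisticPolicy past f b π) (hb : 0 < b)
    (hweight : ∀ c s a, s ≠ M.sH → 0 < M.weight past c s a) (hg : M.IsRewardModel g)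
    (πs : C → S → A) :
    M.meanGap πs π ≤ 2 * b * M.meanBonus past π + (2 * b)⁻¹ * ∑ i, M.sqError f g (past i) := by
  simp only [meanBonus, sqError]
  rw [← M.ctxMean_sum, ← M.ctxMean_const_mul, ← M.ctxMean_const_mul, ← M.ctxMean_add]
  refine M.ctxMean_mono fun c => ?_
  rw [gap, ← hg.value_eq, ← hg.value_eq]
  exact hπ.value_sub_value_le hb (hweight c) (g c) (πs c)

theorem sum_meanGap_le_of_isOptimisticPolicy [Fintype A] {p : ℝ} (hM : M.MinReach p) (hp : 0 < p)
    {g : C → S → A → ℝ} (hg : M.IsRewardModel g) (πs : C → S → A) {T : ℕ} {π : Fin T → C → S → A}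
    {f : Fin T → C → S → A → ℝ} {b : Fin T → ℝ} {B E : ℝ} (hB : 0 ≤ B) (rounds : Finset (Fin T))
    (hπ : ∀ t ∈ rounds, M.IsOptimisticPolicy (Fin.take t t.2.le π) (f t) (b t) (π t))
    (hweight : ∀ t ∈ rounds, ∀ c s a, s ≠ M.sH → 0 < M.weight (Fin.take t t.2.le π) c s a)
    (hb : ∀ t ∈ rounds, 0 < b t) (hbB : ∀ t ∈ rounds, b t ≤ B)
    (hE : ∀ t ∈ rounds, ∑ i, M.sqError (f t) g (Fin.take t t.2.le π i) ≤ E) :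
    ∑ t ∈ rounds, M.meanGap πs (π t) ≤
      2 * B * (p⁻¹ * (Fintype.card S * (Fintype.card A * (1 + Real.log T)))) +
        (∑ t ∈ rounds, (2 * b t)⁻¹) * E := by
  have hround (t : Fin T) (ht : t ∈ rounds) : M.meanGap πs (π t) ≤
      2 * B * M.meanBonus (Fin.take t t.2.le π) (π t) + (2 * b t)⁻¹ * E := by
    have hbonus := M.meanBonus_nonneg (Fin.take t t.2.le π) (π t)
    have hinv : 0 ≤ (2 * b t)⁻¹ := inv_nonneg.2 (by linarith [hb t ht])
    refine ((hπ t ht).meanGap_le (hb t ht) (hweight t ht) hg πs).trans ?_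
    gcongr
    exacts [hbB t ht, hE t ht]
  calc ∑ t ∈ rounds, M.meanGap πs (π t)
    _ ≤ 2 * B * ∑ t ∈ rounds, M.meanBonus (Fin.take t t.2.le π) (π t) +
          (∑ t ∈ rounds, (2 * b t)⁻¹) * E := by
        rw [Finset.mul_sum, Finset.sum_mul, ← Finset.sum_add_distrib]
        exact Finset.sum_le_sum hround
    _ ≤ _ := by
        gcongr
        exact (Finset.sum_le_univ_sum_of_nonneg fun t => M.meanBonus_nonneg _ _).trans
          (hM.sum_meanBonus_le hp π)

end Optimism

end LayeredCMDP

namespace RMKD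

variable {C S A : Type*} {H : ℕ} {M : LayeredCMDP C S A H} [Fintype S] [Fintype A]
  [MeasurableSpace C] [MeasurableSpace S] [MeasurableSpace A] {F : Finset (C → S → A → ℝ)}
  {β : ℕ → ℝ} (alg : RMKD M F β)

theorem isOptimisticPolicy {t : ℕ} (ht : Fintype.card A ≤ t) (hist : Hist C S A H t) :
    M.IsOptimisticPolicy (played alg.policy hist) (alg.fhat t hist) (β (t + 1))
      (alg.policy t hist) :=
  alg.policy_opt t ht hist

theorem playCount_pos {t : ℕ} (ht : Fintype.card A ≤ t) (hist : Hist C S A H t) (c : C) (s : S)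
    (a : A) : 0 < LayeredCMDP.playCount (played alg.policy hist) c s a := by
  classical
  refine Finset.card_pos.2 ⟨(alg.order.symm a).castLE ht, (Finset.mem_filter_univ _).2 ?_⟩
  change alg.policy (alg.order.symm a) _ c s = a
  rw [alg.policy_init _ (alg.order.symm a).2, Fin.eta, Equiv.apply_symm_apply]

theorem weight_pos {p : ℝ} (hM : M.MinReach p) (hp : 0 < p) {t : ℕ} (ht : Fintype.card A ≤ t)
    (hist : Hist C S A H t) (c : C) {s : S} (hs : s ≠ M.sH) (a : A) :
    0 < M.weight (played alg.policy hist) c s a :=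
  (mul_pos hp (Nat.cast_pos.2 (alg.playCount_pos ht hist c s a))).trans_le
    (hM.playCount_le_weight _ c hs a)

variable [Fintype C]

theorem sum_sqError_fhat_le {g : C → S → A → ℝ} (hg : g ∈ F) {Λ : ℝ} {T : ℕ}
    {hist : Hist C S A H T} (hhist : hist ∈ M.lsqConfidence alg.policy F g Λ T) (t : Fin T)
    (ht : Fintype.card A ≤ t) :
    ∑ i, M.sqError (alg.fhat t (hist.pre t)) g (played alg.policy (hist.pre t) i) ≤
      16 * H * Λ := by
  have herr := hhist t _ (alg.fhat_mem t ht (hist.pre t))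
  have hlsq := alg.fhat_le t ht (hist.pre t) g hg
  linarith

theorem sum_meanGap_init_le (πs : C → S → A) {T : ℕ} (hist : Hist C S A H T) :
    ∑ t : Fin T with t.val < Fintype.card A, M.meanGap πs (played alg.policy hist t) ≤
      Fintype.card A * H := by
  refine (Finset.sum_le_card_nsmul _ (fun t => M.meanGap πs (played alg.policy hist t)) (H : ℝ)
    fun t _ => M.meanGap_le πs _).trans ?_
  rw [nsmul_eq_mul, Fin.card_filter_val_lt]
  gcongr
  exact min_le_right _ _

theorem sum_meanGap_le {p : ℝ} (hM : M.MinReach p) (hp : 0 < p) {g : C → S → A → ℝ} (hgF : g ∈ F)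
    (hg : M.IsRewardModel g) (πs : C → S → A) {B Λ : ℝ} (hΛ : 0 ≤ Λ) {T : ℕ} (hB : 0 ≤ B)
    (hβ : ∀ t < T, 0 < β (t + 1)) (hβB : ∀ t < T, β (t + 1) ≤ B) {hist : Hist C S A H T}
    (hhist : hist ∈ M.lsqConfidence alg.policy F g Λ T) :
    ∑ t, M.meanGap πs (played alg.policy hist t) ≤ Fintype.card A * H +
      (2 * B * (p⁻¹ * (Fintype.card S * (Fintype.card A * (1 + Real.log T)))) +
        (∑ t ∈ Finset.range T, (2 * β (t + 1))⁻¹) * (16 * H * Λ)) := by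
  let rounds : Finset (Fin T) := {t | ¬t.val < Fintype.card A}
  have hge (t : Fin T) (ht : t ∈ rounds) : Fintype.card A ≤ t :=
    not_lt.1 ((Finset.mem_filter_univ t).1 ht)
  have hlate := LayeredCMDP.sum_meanGap_le_of_isOptimisticPolicy hM hp hg πs
    (π := played alg.policy hist) (f := fun t => alg.fhat t (hist.pre t))
    (b := fun t => β (t + 1)) hB rounds
    (fun t ht => alg.isOptimisticPolicy (hge t ht) (hist.pre t))
    (fun t ht c s a hs => alg.weight_pos hM hp (hge t ht) (hist.pre t) c hs a)
    (fun t _ => hβ t t.2) (fun t _ => hβB t t.2)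
    (fun t ht => alg.sum_sqError_fhat_le hgF hhist t (hge t ht))
  have hinv : ∑ t ∈ rounds, (2 * β (t + 1))⁻¹ ≤ ∑ t ∈ Finset.range T, (2 * β (t + 1))⁻¹ := by
    rw [← Fin.sum_univ_eq_sum_range fun t => (2 * β (t + 1))⁻¹]
    exact Finset.sum_le_univ_sum_of_nonneg fun t => inv_nonneg.2 (by linarith [hβ t t.2])
  rw [← Finset.sum_filter_add_sum_filter_not _ fun t : Fin T => t.val < Fintype.card A]
  refine add_le_add (alg.sum_meanGap_init_le πs hist) (hlate.trans ?_)
  gcongr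

end RMKD

section ConfidenceRadius

theorem log_two_le_log_two_mul_div {n : ℕ} (hn : 1 ≤ n) {δ : ℝ} (hδ : 0 < δ) (hδ1 : δ ≤ 1) :
    Real.log 2 ≤ Real.log (2 * n / δ) := by
  have hn' : (1 : ℝ) ≤ n := mod_cast hn
  refine Real.log_le_log two_pos ((le_div_iff₀ hδ).2 ?_)
  nlinarith

theorem log_confidence_le {n T : ℕ} (hn : 1 ≤ n) (hT : 1 ≤ T) {δ : ℝ} (hδ : 0 < δ) (hδ1 : δ ≤ 1) :
    Real.log (1 / (δ / (2 * n * T))) ≤ 2 * (1 + Real.log T) * Real.log (2 * n / δ) := by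
  have hsplit : 1 / (δ / (2 * n * T)) = 2 * n / δ * T := by field_simp
  rw [hsplit, Real.log_mul (by positivity) (by positivity)]
  nlinarith [log_two_le_log_two_mul_div hn hδ hδ1, Real.log_two_gt_d9, Real.log_natCast_nonneg T]

theorem log_beta_le {n t : ℕ} (hn : 1 ≤ n) (ht : 1 ≤ t) {δ : ℝ} (hδ : 0 < δ) (hδ1 : δ ≤ 1) :
    Real.log (4 * n * t ^ 3 / δ) ≤ 6 * (1 + Real.log t) * Real.log (2 * n / δ) := by
  have hsplit : 4 * n * (t : ℝ) ^ 3 / δ = 2 * (2 * n / δ) * (t : ℝ) ^ 3 := by ring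
  rw [hsplit, Real.log_mul (by positivity) (by positivity),
    Real.log_mul two_ne_zero (by positivity), Real.log_pow]
  push_cast
  nlinarith [log_two_le_log_two_mul_div hn hδ hδ1, Real.log_two_gt_d9, Real.log_natCast_nonneg t]

theorem le_beta {n : ℕ} (hn : 1 ≤ n) {δ : ℝ} (hδ : 0 < δ) (hδ1 : δ ≤ 1) (s a : ℕ) {t : ℕ}
    (ht : 1 ≤ t) : 4 * √(Real.log (2 * n / δ) / (s * a)) * √t ≤ beta n s a δ t := by
  have ht' : (1 : ℝ) ≤ t := mod_cast ht
  have hl : 0 ≤ Real.log (2 * n / δ) :=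
    (Real.log_nonneg one_le_two).trans (log_two_le_log_two_mul_div hn hδ hδ1)
  have hlog : Real.log (2 * n / δ) ≤ Real.log (4 * n * t ^ 3 / δ) := by
    refine Real.log_le_log (by positivity) ?_
    gcongr ?_ / _
    nlinarith [one_le_pow₀ ht' (n := 3)]
  refine Real.le_sqrt_of_sq_le ?_
  rw [mul_pow, mul_pow, Real.sq_sqrt (by positivity), Real.sq_sqrt (by positivity)]
  calc 4 ^ 2 * (Real.log (2 * n / δ) / (s * a)) * t
    _ = 16 * t * Real.log (2 * n / δ) / (s * a) := by ring
    _ ≤ 17 * t * Real.log (4 * n * t ^ 3 / δ) / (s * a) := by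
        gcongr
        norm_num

theorem beta_le {n : ℕ} (hn : 1 ≤ n) {δ : ℝ} (hδ : 0 < δ) (hδ1 : δ ≤ 1) (s a : ℕ) {t T : ℕ}
    (ht : 1 ≤ t) (htT : t ≤ T) : beta n s a δ t ≤
      11 * (1 + Real.log T) * √(Real.log (2 * n / δ) / (s * a)) * √T := by
  have hl : 0 ≤ Real.log (2 * n / δ) :=
    (Real.log_nonneg one_le_two).trans (log_two_le_log_two_mul_div hn hδ hδ1)
  have hu := Real.log_natCast_nonneg T
  refine Real.sqrt_le_iff.2 ⟨by positivity, ?_⟩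
  rw [mul_pow, mul_pow, Real.sq_sqrt (by positivity), Real.sq_sqrt (by positivity)]
  calc 17 * t * Real.log (4 * n * t ^ 3 / δ) / (s * a)
    _ ≤ 17 * t * (6 * (1 + Real.log t) * Real.log (2 * n / δ)) / (s * a) := by
        gcongr
        exact log_beta_le hn ht hδ hδ1
    _ ≤ 17 * T * (6 * (1 + Real.log T) * Real.log (2 * n / δ)) / (s * a) := by gcongr
    _ = 102 * (1 + Real.log T) * (Real.log (2 * n / δ) / (s * a)) * T := by ring
    _ ≤ (11 * (1 + Real.log T)) ^ 2 * (Real.log (2 * n / δ) / (s * a)) * T := by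
        gcongr
        nlinarith

theorem sum_inv_sqrt_le (T : ℕ) : ∑ t ∈ Finset.range T, (√(t + 1 : ℕ))⁻¹ ≤ 2 * √T := by
  induction T with
  | zero => simp
  | succ T ih =>
    have hpos : 0 < √(T + 1 : ℕ) := by positivity
    have hsq := Real.sq_sqrt (Nat.cast_nonneg (α := ℝ) T)
    have hsq' := Real.sq_sqrt (Nat.cast_nonneg (α := ℝ) (T + 1))
    have hinv : (√(T + 1 : ℕ))⁻¹ ≤ 2 * (√(T + 1 : ℕ) - √T) := by
      rw [inv_le_iff_one_le_mul₀ hpos]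
      push_cast at hsq' ⊢
      nlinarith [sq_nonneg (√(T + 1) - √T)]
    rw [Finset.sum_range_succ]
    linarith

theorem sum_inv_beta_le {n : ℕ} (hn : 1 ≤ n) {δ : ℝ} (hδ : 0 < δ) (hδ1 : δ ≤ 1) {s a : ℕ}
    (hs : 1 ≤ s) (ha : 1 ≤ a) (T : ℕ) :
    ∑ t ∈ Finset.range T, (2 * beta n s a δ (t + 1))⁻¹ ≤
      √T / (4 * √(Real.log (2 * n / δ) / (s * a))) := by
  have hl : 0 < Real.log (2 * n / δ) :=
    (Real.log_pos one_lt_two).trans_le (log_two_le_log_two_mul_div hn hδ hδ1)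
  have hρ : 0 < √(Real.log (2 * n / δ) / (s * a)) := by positivity
  set ρ := √(Real.log (2 * n / δ) / (s * a))
  calc ∑ t ∈ Finset.range T, (2 * beta n s a δ (t + 1))⁻¹
    _ ≤ ∑ t ∈ Finset.range T, (8 * ρ)⁻¹ * (√(t + 1 : ℕ))⁻¹ := by
        refine Finset.sum_le_sum fun t _ => ?_
        rw [← mul_inv]
        refine inv_anti₀ (by positivity) ?_
        linarith [le_beta hn hδ hδ1 s a (Nat.le_add_left 1 t)]
    _ ≤ (8 * ρ)⁻¹ * (2 * √T) := by
        rw [← Finset.mul_sum]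
        gcongr
        exact sum_inv_sqrt_le T
    _ = √T / (4 * ρ) := by
        field_simp
        ring

theorem bonus_add_error_eq {s a l : ℝ} (hs : 0 < s) (ha : 0 < a) (hl : 0 < l) (T u q h : ℝ) :
    2 * (11 * u * √(l / (s * a)) * √T) * (q * (s * (a * u))) +
        √T / (4 * √(l / (s * a))) * (16 * h * (2 * u * l)) =
      (22 * u ^ 2 * q + 8 * u * h) * √(T * s * a * l) := by
  have hρ : 0 < √(l / (s * a)) := by positivity
  have hl_eq : l = √(l / (s * a)) ^ 2 * (s * a) := by
    rw [Real.sq_sqrt (by positivity)]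
    field_simp
  have hsqrt : √(T * s * a * l) = √T * (√(l / (s * a)) * (s * a)) := by
    rw [← Real.sqrt_sq (by positivity : 0 ≤ √(l / (s * a)) * (s * a)),
      ← Real.sqrt_mul' _ (by positivity), mul_pow, Real.sq_sqrt (by positivity)]
    congr 1
    field_simp
  rw [hsqrt]
  set ρ := √(l / (s * a))
  rw [hl_eq]
  field_simp
  ring

theorem sqrt_log_two_div_le {n s a : ℕ} (hn : 1 ≤ n) (hs : 1 ≤ s) (ha : 1 ≤ a) {δ : ℝ}
    (hδ : 0 < δ) (hδ1 : δ ≤ 1) (T : ℕ) :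
    √(T * Real.log (1 / (δ / 2))) ≤ √(T * s * a * Real.log (2 * n / δ)) := by
  have hn' : (1 : ℝ) ≤ n := mod_cast hn
  have hsa : (1 : ℝ) ≤ s * a := mod_cast Nat.mul_pos hs ha
  have hlog : Real.log (1 / (δ / 2)) ≤ Real.log (2 * n / δ) := by
    rw [one_div_div]
    gcongr
    linarith
  have hl : 0 ≤ Real.log (2 * n / δ) :=
    (Real.log_nonneg one_le_two).trans (log_two_le_log_two_mul_div hn hδ hδ1)
  rw [mul_assoc (T : ℝ), mul_assoc (T : ℝ)]
  gcongr
  exact hlog.trans (le_mul_of_one_le_left hl hsa)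

theorem two_mul_add_mul_le_rate {u q h R a x y : ℝ} (hu : 1 ≤ u) (hh : 0 ≤ h) (hR : 0 ≤ R)
    (ha : 0 ≤ a) (hx : x ≤ a * h + (22 * u ^ 2 * q + 8 * u * h) * R) (hy : y ≤ R) :
    2 * x + h * y ≤ 44 * u ^ 2 * ((q + h) * R + a * h) := by
  have hu2 : u ≤ u ^ 2 := by nlinarith
  have hhR : 0 ≤ h * R := by positivity
  have : 0 ≤ a * h := by positivity
  calc 2 * x + h * y
    _ ≤ 2 * (a * h + (22 * u ^ 2 * q + 8 * u * h) * R) + h * R := by gcongr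
    _ = 44 * u ^ 2 * (q * R) + 16 * u * (h * R) + 1 * (h * R) + 2 * (a * h) := by ring
    _ ≤ 44 * u ^ 2 * (q * R) + 16 * u ^ 2 * (h * R) + u ^ 2 * (h * R) + 44 * u ^ 2 * (a * h) := by
        gcongr <;> nlinarith
    _ ≤ 44 * u ^ 2 * ((q + h) * R + a * h) := by nlinarith [mul_nonneg (sq_nonneg u) hhR]

theorem natCast_le_two_mul_sqrt {n s a T : ℕ} (hn : 1 ≤ n) (hs : 1 ≤ s) {δ : ℝ} (hδ : 0 < δ)
    (hδ1 : δ ≤ 1) (haT : a ≤ T) : (a : ℝ) ≤ 2 * √(T * s * a * Real.log (2 * n / δ)) := by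
  have hs' : (1 : ℝ) ≤ s := mod_cast hs
  have hl := log_two_le_log_two_mul_div hn hδ hδ1
  have hsqrt : (a : ℝ) / 2 ≤ √(T * s * a * Real.log (2 * n / δ)) := by
    refine Real.le_sqrt_of_sq_le ?_
    calc ((a : ℝ) / 2) ^ 2
      _ ≤ a * 1 * a * (1 / 2) := by nlinarith [sq_nonneg (a : ℝ)]
      _ ≤ T * s * a * Real.log (2 * n / δ) := by
          gcongr
          linarith [Real.log_two_gt_d9]
  linarith

theorem initial_cost_absorbed {u q h R a : ℝ} (hq : 0 ≤ q) (hh : 0 ≤ h) (hR : 0 ≤ R)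
    (ha : a ≤ 2 * R) :
    44 * u ^ 2 * ((q + h) * R + a * h) ≤ 132 * u ^ 2 * ((q + h) * R) :=
  calc 44 * u ^ 2 * ((q + h) * R + a * h)
    _ ≤ 44 * u ^ 2 * ((q + h) * R + 2 * R * (q + h)) := by
        gcongr
        linarith
    _ = 132 * u ^ 2 * ((q + h) * R) := by ring

end ConfidenceRadius

theorem ofReal_one_sub_le_measure {Ω : Type*} [MeasurableSpace Ω] {μ : Measure Ω}
    [IsProbabilityMeasure μ] {s : Set Ω} {δ : ℝ} (hδ : 0 ≤ δ) (hs : μ sᶜ ≤ ENNReal.ofReal δ) :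
    ENNReal.ofReal (1 - δ) ≤ μ s := by
  rw [ENNReal.ofReal_sub _ hδ, ENNReal.ofReal_one, tsub_le_iff_right, ← measure_univ (μ := μ),
    ← Set.union_compl_self s]
  exact (measure_union_le s sᶜ).trans (by gcongr)

theorem le_measure_setOf_le_of_le {Ω : Type*} [MeasurableSpace Ω] {μ : Measure Ω} {f : Ω → ℝ}
    {x y : ℝ} {e : ENNReal} (h : e ≤ μ {ω | f ω ≤ x}) (hxy : x ≤ y) : e ≤ μ {ω | f ω ≤ y} :=
  h.trans (measure_mono fun _ hω => le_trans hω hxy)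

namespace RMKD

section Bound

variable {C S A : Type*} {H : ℕ} {M : LayeredCMDP C S A H} [Fintype C] [Fintype S] [Fintype A]
  [MeasurableSpace C] [MeasurableSpace S] [MeasurableSpace A] {F : Finset (C → S → A → ℝ)}
  {δ : ℝ} (alg : RMKD M F (beta F.card (Fintype.card S) (Fintype.card A) δ))

theorem sum_meanGap_beta_le {p : ℝ} (hM : M.MinReach p) (hp : 0 < p) {g : C → S → A → ℝ}
    (hgF : g ∈ F) (hg : M.IsRewardModel g) (πs : C → S → A) [Nonempty A] (hδ : 0 < δ) (hδ1 : δ ≤ 1)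
    {T : ℕ} (hT : 1 ≤ T) {hist : Hist C S A H T}
    (hhist : hist ∈ M.lsqConfidence alg.policy F g (Real.log (1 / (δ / (2 * F.card * T)))) T) :
    ∑ t, M.meanGap πs (played alg.policy hist t) ≤ Fintype.card A * H +
      (22 * (1 + Real.log T) ^ 2 * p⁻¹ + 8 * (1 + Real.log T) * H) *
        √(T * Fintype.card S * Fintype.card A * Real.log (2 * F.card / δ)) := by
  have hn : 1 ≤ F.card := Finset.card_pos.2 ⟨g, hgF⟩
  have hS : 1 ≤ Fintype.card S := Fintype.card_pos_iff.2 ⟨M.s₀⟩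
  have hA : 1 ≤ Fintype.card A := Fintype.card_pos
  have := Real.log_natCast_nonneg T
  have hl : 0 < Real.log (2 * F.card / δ) :=
    (Real.log_pos one_lt_two).trans_le (log_two_le_log_two_mul_div hn hδ hδ1)
  have hlower (t : ℕ) := le_beta hn hδ hδ1 (Fintype.card S) (Fintype.card A) (Nat.le_add_left 1 t)
  have hupper {t : ℕ} (ht : t < T) := beta_le hn hδ hδ1 (Fintype.card S) (Fintype.card A)
    (Nat.le_add_left 1 t) ht
  have hinv := sum_inv_beta_le hn hδ hδ1 hS hA T
  have hΛ := log_confidence_le hn hT hδ hδ1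
  have hΛ0 : 0 ≤ Real.log (1 / (δ / (2 * F.card * T))) := by
    have hnT : (1 : ℝ) ≤ F.card * T := mod_cast Nat.mul_pos hn hT
    refine Real.log_nonneg ?_
    rw [one_div_div, one_le_div hδ]
    linarith
  refine (alg.sum_meanGap_le hM hp hgF hg πs hΛ0 (by positivity)
    (fun t _ => (hlower t).trans_lt' (by positivity)) (fun t => hupper) hhist).trans ?_
  rw [← bonus_add_error_eq (by positivity) (by positivity) hl]
  gcongr

variable [MeasurableSingletonClass C] [MeasurableSingletonClass S] [MeasurableSingletonClass A]

theorem regret_bound {p : ℝ} {πs : C → S → A} (hM : M.MinReach p) (hp : 0 < p)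
    (hF : ∀ f ∈ F, ∀ c s a, f c s a ∈ Set.Icc (0 : ℝ) 1) (hreal : M.Realizable F)
    (hδ : 0 < δ) (hδ1 : δ ≤ 1) {T : ℕ} (hT : 1 ≤ T) (hπs : M.IsOptimal πs) :
    ENNReal.ofReal (1 - δ) ≤ M.histLaw alg.policy T {hist | M.regret πs alg.policy hist ≤
      44 * (1 + Real.log T) ^ 2 * ((1 / p + H) * √(T * Fintype.card S * Fintype.card A *
        Real.log (2 * F.card / δ)) + Fintype.card A * H)} := by
  have hn : 1 ≤ F.card := hreal.nonempty.card_pos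
  obtain ⟨g, hgF, hg⟩ := hreal
  obtain ⟨c₀, -⟩ := M.ctxDist.support_nonempty
  have : Nonempty A := ⟨πs c₀ M.s₀⟩
  have hsqrt := sqrt_log_two_div_le hn (Fintype.card_pos_iff.2 ⟨M.s₀⟩)
    (Fintype.card_pos : 0 < Fintype.card A) hδ hδ1 T
  have hu := Real.log_natCast_nonneg T
  have := M.isProbabilityMeasure_histLaw alg.measurable_policy T
  have hconf := M.histLaw_compl_lsqConfidence_le alg.measurable_policy hF (hF g hgF) hg T
    (ε := δ / (2 * F.card * T)) (by positivity)
  have hdev := M.histLaw_regret_sqrt_le alg.measurable_policy hπs T (half_pos hδ)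
  refine ofReal_one_sub_le_measure hδ.le ?_
  calc M.histLaw alg.policy T _
    _ ≤ M.histLaw alg.policy T (_ ∪ _) := measure_mono fun hist hhist => ?_
    _ ≤ ENNReal.ofReal (T * F.card * (δ / (2 * F.card * T))) + ENNReal.ofReal (δ / 2) :=
      (measure_union_le _ _).trans (add_le_add hconf hdev)
    _ = ENNReal.ofReal δ := by
        rw [← ENNReal.ofReal_add (by positivity) (by positivity)]
        congr 1
        field_simp
        norm_num
  rw [Set.mem_compl_iff, Set.mem_ofPred_eq] at hhist
  by_contra hgood
  rw [Set.mem_union, Set.mem_compl_iff, not_or, not_not] at hgood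
  refine hhist ((not_lt.1 hgood.2).trans ?_)
  rw [one_div p]
  exact two_mul_add_mul_le_rate (by linarith) (by positivity) (by positivity) (by positivity)
    (alg.sum_meanGap_beta_le hM hp hgF hg πs hδ hδ1 hT hgood.1) hsqrt

end Bound

end RMKD

theorem card_powClass_le {C S A : Type*} [Fintype S] (G : Finset (C → A → ℝ)) :
    (powClass (S := S) G).card ≤ G.card ^ Fintype.card S := by
  classical
  exact Finset.card_image_le.trans_eq (by simp [Fintype.card_piFinset])

theorem powClass_mem_Icc {C S A : Type*} [Fintype S] {G : Finset (C → A → ℝ)}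
    (hG : ∀ g ∈ G, ∀ c a, g c a ∈ Set.Icc (0 : ℝ) 1) :
    ∀ f ∈ powClass (S := S) G, ∀ c s a, f c s a ∈ Set.Icc (0 : ℝ) 1 := by
  classical
  intro f hf c s a
  obtain ⟨g, hg, rfl⟩ := Finset.mem_image.1 hf
  exact hG _ (Fintype.mem_piFinset.1 hg s) c a

theorem log_card_powClass_le {C S A : Type*} [Fintype S] [Nonempty S] {G : Finset (C → A → ℝ)}
    (hG : (powClass (S := S) G).Nonempty) {δ : ℝ} (hδ : 0 < δ) (hδ1 : δ ≤ 1) :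
    Real.log (2 * (powClass (S := S) G).card / δ) ≤
      Fintype.card S * Real.log (2 * G.card / δ) := by
  have : (0 : ℝ) < (powClass (S := S) G).card := mod_cast hG.card_pos
  have hcard : ((powClass (S := S) G).card : ℝ) ≤ G.card ^ Fintype.card S :=
    mod_cast card_powClass_le G
  have hone : 1 ≤ 2 / δ := (one_le_div hδ).2 (by linarith)
  rw [← Real.log_pow, mul_div_right_comm, mul_div_right_comm, mul_pow]
  gcongr
  exact le_self_pow₀ hone Fintype.card_ne_zero

theorem sqrt_log_card_powClass_le {C S A : Type*} [Fintype S] [Nonempty S]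
    {G : Finset (C → A → ℝ)} (hG : (powClass (S := S) G).Nonempty) {δ : ℝ} (hδ : 0 < δ)
    (hδ1 : δ ≤ 1) (T a : ℕ) :
    √(T * Fintype.card S * a * Real.log (2 * (powClass (S := S) G).card / δ)) ≤
      Fintype.card S * √(T * a * Real.log (2 * G.card / δ)) := by
  rw [← Real.sqrt_sq (Nat.cast_nonneg (Fintype.card S)), ← Real.sqrt_mul (by positivity),
    Real.sqrt_sq (Nat.cast_nonneg _)]
  refine Real.sqrt_le_sqrt ?_
  calc T * Fintype.card S * a * Real.log (2 * (powClass (S := S) G).card / δ)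
    _ ≤ T * Fintype.card S * a * (Fintype.card S * Real.log (2 * G.card / δ)) := by
        gcongr
        exact log_card_powClass_le hG hδ hδ1
    _ = Fintype.card S ^ 2 * (T * a * Real.log (2 * G.card / δ)) := by ring

end CMDP

theorem mainTheorem1 :
    ∃ (K : ℝ) (k : ℕ), 0 < K ∧
      (∀ (C : Type u) (S : Type v) (A : Type w) [Fintype C] [Fintype S] [Fintype A]
        [MeasurableSpace C] [DiscreteMeasurableSpace C] [MeasurableSpace S]
        [DiscreteMeasurableSpace S] [MeasurableSpace A] [DiscreteMeasurableSpace A]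
        (H : ℕ) (M : LayeredCMDP C S A H) (p : ℝ) (F : Finset (C → S → A → ℝ)) (δ : ℝ) (T : ℕ)
        (πs : C → S → A)
        (alg : RMKD M F (beta F.card (Fintype.card S) (Fintype.card A) δ)),
        0 < p → p ≤ 1 → M.MinReach p →
        (∀ f ∈ F, ∀ c s a, f c s a ∈ Set.Icc (0 : ℝ) 1) → M.Realizable F →
        0 < δ → δ < 1 → 1 ≤ T → M.IsOptimal πs →
        ENNReal.ofReal (1 - δ) ≤ M.histLaw alg.policy T {hist | M.regret πs alg.policy hist ≤
          K * (1 + Real.log T) ^ k *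
            ((1 / p + H) * Real.sqrt (T * Fintype.card S * Fintype.card A *
              Real.log (2 * F.card / δ)) + Fintype.card A * H)} ∧
        (Fintype.card A < T →
          ENNReal.ofReal (1 - δ) ≤ M.histLaw alg.policy T {hist | M.regret πs alg.policy hist ≤
            K * (1 + Real.log T) ^ k *
              ((1 / p + H) * Real.sqrt (T * Fintype.card S * Fintype.card A *
                Real.log (2 * F.card / δ)))})) ∧
      (∀ (C : Type u) (S : Type v) (A : Type w) [Fintype C] [Fintype S] [Fintype A]
        [MeasurableSpace C] [DiscreteMeasurableSpace C] [MeasurableSpace S]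
        [DiscreteMeasurableSpace S] [MeasurableSpace A] [DiscreteMeasurableSpace A]
        (H : ℕ) (M : LayeredCMDP C S A H) (p : ℝ) (G : Finset (C → A → ℝ)) (δ : ℝ) (T : ℕ)
        (πs : C → S → A)
        (alg : RMKD M (powClass G)
          (beta (powClass (S := S) G).card (Fintype.card S) (Fintype.card A) δ)),
        0 < p → p ≤ 1 → M.MinReach p →
        (∀ g ∈ G, ∀ c a, g c a ∈ Set.Icc (0 : ℝ) 1) → M.Realizable (powClass G) →
        0 < δ → δ < 1 → 1 ≤ T → M.IsOptimal πs →
        ENNReal.ofReal (1 - δ) ≤ M.histLaw alg.policy T {hist | M.regret πs alg.policy hist ≤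
          K * (1 + Real.log T) ^ k *
            ((1 / p + H) * Fintype.card S * Real.sqrt (T * Fintype.card A *
              Real.log (2 * G.card / δ)) + Fintype.card A * H)} ∧
        (Fintype.card A < T →
          ENNReal.ofReal (1 - δ) ≤ M.histLaw alg.policy T {hist | M.regret πs alg.policy hist ≤
            K * (1 + Real.log T) ^ k *
              ((1 / p + H) * Fintype.card S * Real.sqrt (T * Fintype.card A *
                Real.log (2 * G.card / δ)))})) := by
  refine ⟨132, 2, by norm_num, ?_, ?_⟩
  · intro C S A _ _ _ _ _ _ _ _ _ H M p F δ T πs alg hp _ hM hF hreal hδ hδ1 hT hπs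
    have hbound := alg.regret_bound hM hp hF hreal hδ hδ1.le hT hπs
    refine ⟨le_measure_setOf_le_of_le hbound ?_, fun hAT => le_measure_setOf_le_of_le hbound ?_⟩
    · gcongr
      norm_num
    · exact initial_cost_absorbed (by positivity) (by positivity) (by positivity) <|
        natCast_le_two_mul_sqrt hreal.nonempty.card_pos (Fintype.card_pos_iff.2 ⟨M.s₀⟩)
          hδ hδ1.le hAT.le
  · intro C S A _ _ _ _ _ _ _ _ _ H M p G δ T πs alg hp _ hM hG hreal hδ hδ1 hT hπs
    have : Nonempty S := ⟨M.s₀⟩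
    have hsqrt := sqrt_log_card_powClass_le hreal.nonempty hδ hδ1.le T (Fintype.card A)
    have hbound := alg.regret_bound hM hp (powClass_mem_Icc hG) hreal hδ hδ1.le hT hπs
    simp only [mul_assoc (1 / p + H : ℝ)]
    refine ⟨le_measure_setOf_le_of_le hbound ?_, fun hAT => le_measure_setOf_le_of_le hbound ?_⟩
    · gcongr
      norm_num
    · refine (initial_cost_absorbed (by positivity) (by positivity) (by positivity) <|
        natCast_le_two_mul_sqrt hreal.nonempty.card_pos Fintype.card_pos
          hδ hδ1.le hAT.le).trans ?_
      gcongr
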